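/- Consider the activated random walk model on $\mathbb{Z}$ with sleeping rate $\lambda\in(0,\infty)$ and nearest-neighbour jump distribution $p$, i.e. a probability on $\mathbb{Z}$ with $p(z)=0$ unless $|z|=1$ (any bias is allowed, including totally asymmetric jumps). The state of a site is $n\in\mathbb{N}_0$ ($n$ active particles) or $\varrho$ (one sleeping particle), with the conventions $\varrho+1=2$, $1\cdot\varrho=\varrho$ and $n\cdot\varrho=n$ for $n\ge 2$. If site $x$ contains $k$ active particles, a clock rings at $x$ at rate $(1+\lambda)k$; when it rings, with probability $\frac{\lambda}{1+\lambda}$ the state $\eta(x)$ is replaced by $\eta(x)\cdot\varrho$, and with probability $\frac{p(z)}{1+\lambda}$ one particle jumps from $x$ to $x+z$, that is, $\eta(x)$ becomes $\eta(x)-1$ and $\eta(x+z)$ becomes $\eta(x+z)+1$. Initially all particles are active and the numbers of particles at the sites are i.i.d. Poisson with parameter $\mu\ge 0$. The process $(\eta_t)_{t\ge 0}$ on $\mathbb{Z}$ has càdlàg paths at each site, and its law is the limit, as $n\to\infty$ and in the sense of the joint laws at finitely many times and sites, of the laws of the systems that start with only the particles in $[-n,n]$ (continuous-time Markov chains on a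 countable set). The system locally fixates if for every $x$ the state $\eta_t(x)$ is eventually constant in $t$. Let $\mu_c=\mu_c(\lambda,p)\in[0,\infty]$ be the critical density, i.e. the supremum of the $\mu$ for which the system locally fixates almost surely. Then for every $\lambda>0$ the system locally fixates almost surely whenever $\mu<\frac{\lambda}{1+\lambda}$, and $$\mu_c\;\geqslant\;\frac{\lambda}{1+\lambda}.$$ -/

import Mathlib

open MeasureTheory ProbabilityTheory Filter Topology
open scoped NNReal ENNReal

universe u

noncomputable section

namespace ARW

/-- The state of a site: `num n` means `n` active particles (in particular `num 0` is an empty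
site) and `rho` means exactly one passive (sleeping) particle. -/
inductive SiteState : Type
  | num (n : ℕ)
  | rho

namespace SiteState

instance : Zero SiteState := ⟨num 0⟩

/-- The number of active particles at a site. -/
def active : SiteState → ℕ
  | num n => n
  | rho => 0

/-- A particle arrives: `n + 1`, with `ϱ + 1 = 2` (a sleeping particle is woken up). -/
def addOne : SiteState → SiteState
  | num n => num (n + 1)
  | rho => num 2

/-- A particle leaves: `n - 1`, with `ϱ - 1 = 0`. (At an empty site this is never used.) -/
def subOne : SiteState → SiteState
  | num n => num (n - 1)
  | rho => num 0

/-- A sleep attempt: `1 · ϱ = ϱ`, `ϱ · ϱ = ϱ` and `n · ϱ = n` for `n ≥ 2`. (At an empty site this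
is never used.) -/
def sleep : SiteState → SiteState
  | num 1 => rho
  | num n => num n
  | rho => rho

/-- Injection of site states into the natural numbers. -/
def code : SiteState → ℕ
  | num n => n + 1
  | rho => 0

theorem code_injective : Function.Injective code := by
  intro a b h
  cases a <;> cases b <;> simp_all [code]

instance : Countable SiteState := code_injective.countable

/-- Site states form a countable set, with the discrete σ-algebra. -/
instance : MeasurableSpace SiteState := ⊤

end SiteState

open SiteState

/-- Configurations on `ℤ` with finitely many particles. -/
abbrev FinConfig : Type := ℤ →₀ SiteState

/-- Finite configurations form a countable set, with the discrete σ-algebra. -/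
instance : MeasurableSpace FinConfig := ⊤

instance : DiscreteMeasurableSpace FinConfig := ⟨fun _ => trivial⟩

/-- An instruction: `none` is a sleep attempt, `some z` is a jump by `z`. -/
abbrev Instruction : Type := Option ℤ

/-- The transition `η ↦ τ_{xϱ} η` (instruction `none`) or `η ↦ τ_{x,x+z} η` (instruction
`some z`). -/
def topple (x : ℤ) : Instruction → FinConfig → FinConfig
  | none, η => η.update x (η x).sleep
  | some z, η =>
      let ξ := η.update x (η x).subOne
      ξ.update (x + z) (ξ (x + z)).addOne

/-- The total number of active particles. -/
def totalActive (η : FinConfig) : ℕ := ∑ x ∈ η.support, (η x).active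

theorem tsum_active (η : FinConfig) :
    ∑' x, ((η x).active : ℝ≥0∞) = (totalActive η : ℝ≥0∞) := by
  rw [tsum_eq_sum (s := η.support)]
  · simp [totalActive]
  · intro x hx
    rw [Finsupp.notMem_support_iff.mp hx]
    exact Nat.cast_zero

theorem tsum_option (f : Option ℤ → ℝ≥0∞) : ∑' i, f i = f none + ∑' z : ℤ, f (some z) := by
  rw [← (Equiv.optionEquivSumPUnit.{0} ℤ).symm.tsum_eq f,
    ENNReal.summable.tsum_sum ENNReal.summable, add_comm]
  simp

theorem instruction_tsum (lam : ℝ≥0) (p : PMF ℤ) :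
    ∑' i : Instruction, (i.elim ((lam / (1 + lam) : ℝ≥0) : ℝ≥0∞)
      (fun z => p z * ((1 / (1 + lam) : ℝ≥0) : ℝ≥0∞))) = 1 := by
  rw [tsum_option]
  simp only [Option.elim_none, Option.elim_some]
  rw [ENNReal.tsum_mul_right, p.tsum_coe, one_mul, ← ENNReal.coe_add, ← add_div, add_comm lam 1,
    div_self (by positivity), ENNReal.coe_one]

/-- When the clock of a site rings, the instruction is to sleep with probability `λ / (1 + λ)`,
and to jump by `z` with probability `p z / (1 + λ)`. -/
def instructionLaw (lam : ℝ≥0) (p : PMF ℤ) : PMF Instruction :=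
  ⟨fun i => i.elim ((lam / (1 + lam) : ℝ≥0) : ℝ≥0∞)
      (fun z => p z * ((1 / (1 + lam) : ℝ≥0) : ℝ≥0∞)),
    instruction_tsum lam p ▸ ENNReal.summable.hasSum⟩

/-- The site whose clock rings first: since the clock of `x` rings at rate `(1 + λ) ⟦η x⟧`,
it is `x` with probability `⟦η x⟧ / ∑ y, ⟦η y⟧`. -/
def ringingSite (η : FinConfig) (h : totalActive η ≠ 0) : PMF ℤ :=
  PMF.normalize (fun x => ((η x).active : ℝ≥0∞))
    (by rw [tsum_active]; exact_mod_cast h)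
    (by rw [tsum_active]; exact ENNReal.natCast_ne_top _)

open Classical in
/-- The law of the configuration reached from `η` when the first clock rings. A configuration
without active particles is absorbing. -/
def step (lam : ℝ≥0) (p : PMF ℤ) (η : FinConfig) : PMF FinConfig :=
  if h : totalActive η = 0 then PMF.pure η
  else (ringingSite η h).bind fun x => (instructionLaw lam p).map fun i => topple x i η

/-- The embedded jump chain, as a Markov kernel from the past of the chain: the next configuration
depends only on the current one. -/
def stepKernel (lam : ℝ≥0) (p : PMF ℤ) (k : ℕ) :
    Kernel ((i : Finset.Iic k) → (fun _ : ℕ => FinConfig) i) FinConfig :=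
  Kernel.comap (Kernel.ofFunOfCountable fun η : FinConfig => (step lam p η).toMeasure)
    (fun past => past ⟨k, Finset.mem_Iic.mpr le_rfl⟩) (measurable_pi_apply _)

instance (lam : ℝ≥0) (p : PMF ℤ) (k : ℕ) : IsMarkovKernel (stepKernel lam p k) := by
  constructor
  intro past
  rw [stepKernel, Kernel.comap_apply]
  exact PMF.toMeasure.isProbabilityMeasure _

/-- Keep only the particles in `[-n, n]`; all of them are active. -/
def truncate (n : ℕ) (ζ : ℤ → ℕ) : FinConfig :=
  Finsupp.onFinset (Finset.Icc (-(n : ℤ)) n)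
    (fun x => if x ∈ Finset.Icc (-(n : ℤ)) n then num (ζ x) else 0)
    (by intro x hx; by_contra h; simp [h] at hx)

/-- The law of the initial configuration of the system restricted to the particles that start in
`[-n, n]`: i.i.d. Poisson(`μ`) numbers of active particles, truncated to `[-n, n]`. -/
def initialLaw (μ : ℝ≥0) (n : ℕ) : Measure FinConfig :=
  (Measure.infinitePi fun _ : ℤ => poissonMeasure μ).map (truncate n)

/-- Sample space of the jump-and-hold construction: the sequence of configurations visited, and
a sequence of standard exponential variables. -/
abbrev FinSample : Type := (ℕ → FinConfig) × (ℕ → ℝ)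

/-- The law of the system on `ℤ` started from the particles in `[-n, n]`: the jump chain and
independent i.i.d. exponential variables of parameter `1`. -/
def finLaw (lam : ℝ≥0) (p : PMF ℤ) (μ : ℝ≥0) (n : ℕ) : Measure FinSample :=
  (Kernel.trajMeasure (X := fun _ : ℕ => FinConfig) (initialLaw μ n) (stepKernel lam p)).prod
    (Measure.infinitePi fun _ : ℕ => expMeasure 1)

/-- The time of the `k`-th ring: the holding time in a configuration `η` is exponential with
parameter the total rate `(1 + λ) ∑ x, ⟦η x⟧` (it is `∞` if there is no active particle). -/
def ringTime (lam : ℝ≥0) (ω : FinSample) (k : ℕ) : ℝ≥0∞ :=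
  ∑ i ∈ Finset.range k,
    ENNReal.ofReal (ω.2 i) / (((1 + lam) * (totalActive (ω.1 i) : ℝ≥0) : ℝ≥0) : ℝ≥0∞)

/-- The configuration of the finite system at time `t`: the configuration of the jump chain after
the `k` rings that occur up to time `t`. -/
def finState (lam : ℝ≥0) (ω : FinSample) (t : ℝ≥0) : FinConfig :=
  ω.1 (sInf {k : ℕ | (t : ℝ≥0∞) < ringTime lam ω (k + 1)})

/-- `η` is an activated random walk process on `ℤ` with sleeping rate `lam`, jump distribution `p`
and i.i.d. Poisson(`μ`) initial condition, defined on the probability space `(Ω, P)`: it has càdlàg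
paths (for the discrete topology at each site), and its law is the infinite-volume limit of the laws
of the systems that start with only the particles in `[-n, n]`, that is, the joint law of its states
at finitely many times and sites is the limit as `n → ∞` of those of the finite systems.
(With all times equal to `0` this says that the `η 0 x` are i.i.d. Poisson numbers of active
particles.) -/
structure IsProcess (lam : ℝ≥0) (p : PMF ℤ) (μ : ℝ≥0) {Ω : Type u} [MeasurableSpace Ω]
    (P : Measure Ω) (η : ℝ≥0 → Ω → ℤ → SiteState) : Prop where
  measurable : ∀ t x, Measurable fun ω => η t ω x
  right_continuous : ∀ᵐ ω ∂P, ∀ x t, ∀ᶠ s in 𝓝[>] t, η s ω x = η t ω x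
  left_limits : ∀ᵐ ω ∂P, ∀ x t, ∃ a : SiteState, ∀ᶠ s in 𝓝[<] t, η s ω x = a
  law : ∀ (S : Finset (ℝ≥0 × ℤ)) (v : ℝ≥0 × ℤ → SiteState),
    Tendsto (fun n : ℕ => finLaw lam p μ n {ω | ∀ i ∈ S, finState lam ω i.1 i.2 = v i}) atTop
      (𝓝 (P {ω | ∀ i ∈ S, η i.1 ω i.2 = v i}))

/-- A trajectory locally fixates if the state of each site is eventually constant. -/
def LocallyFixates (η : ℝ≥0 → ℤ → SiteState) : Prop :=
  ∀ x, ∃ a : SiteState, ∀ᶠ t in atTop, η t x = a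

/-- The activated random walk system with the given parameters locally fixates almost surely.
(The law of the process is determined by the parameters, whatever the space it is defined on.) -/
def FixatesAS (lam : ℝ≥0) (p : PMF ℤ) (μ : ℝ≥0) : Prop :=
  ∀ (Ω : Type u) [MeasurableSpace Ω] (P : Measure Ω) [IsProbabilityMeasure P]
    (η : ℝ≥0 → Ω → ℤ → SiteState),
    IsProcess lam p μ P η → ∀ᵐ ω ∂P, LocallyFixates fun t => η t ω

/-- The critical density `μ_c ∈ [0, ∞]`: the supremum of the densities at which the system
fixates almost surely. -/
def criticalDensity (lam : ℝ≥0) (p : PMF ℤ) : ℝ≥0∞ :=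
  ⨆ (μ : ℝ≥0) (_ : FixatesAS.{u} lam p μ), (μ : ℝ≥0∞)

end ARW

end

/-! Give every site an independent stack of i.i.d. instructions, and let each ring at a site use the
next instruction there. Suppose that performing the first `h y` instructions at each `y` would leave
every site stable. Then `h`, even if it comes from no legal sequence and has infinite support,
bounds what legal topplings can do at a given site, in whatever order they occur (`StableAt.topple`,
`Reach.le_of_stable`). So it suffices to find, with probability close to one and for all truncations
at once, a stable `h` with a prescribed value `H` at `x`.

Such an `h` is built outwards along half-lines. Let `f_j` be the net flow towards `x` across the
`j`-th edge and `a_j` the number of jumps away from `x` across it. The next site has to send `f_j +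
a_j` particles towards `x`: its stack is read up to that many such jumps, and one instruction
further if this is a sleep attempt, in which case one particle may stay. Conservation of particles
then reads `f_{j+1} = f_j + 1{sleep} - ζ_{j+1}`. The extra instruction is fresh
(`lintegral_eval_hit`), so `f` is a random walk with drift `λ/(1+λ) - μ > 0`. The construction
succeeds if `f_j + a_j` never becomes negative. Far from `x` this follows from an exponential moment
bound that is uniform in `H` (`lintegral_side_le`); near `x`, `f_j + a_j` tends to infinity with `H`
(`tendsto_side`). If both jump directions have positive probability, two half-lines are glued at
`x`; otherwise the upstream half-line is enough, since nothing enters it from outside.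

The process itself is never coupled with the stacks. The probability that the stacks allow `c` more
changes at `x` is superharmonic for the jump chain (`lintegral_step_le`), so the number of changes
at `x` is tight uniformly over the finite systems (`finLaw_changes_le`). Fatou's lemma over finite
sets of times, followed by right-continuity, transfers this to the infinite system
(`fixatesAS_of_tight`). -/

noncomputable section

namespace ARW

/-! ### Stacks of instructions, legal topplings and stability. -/

/-- The number of particles at a site, active or sleeping. -/
def SiteState.particles : SiteState → ℕ
  | .num n => n
  | .rho => 1

/-- A stack of instructions at each site. -/
abbrev Field : Type := ℤ → ℕ → Instruction

/-- Discard the first instruction at `y`. -/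
def shiftAt (y : ℤ) (F : Field) : Field := Function.update F y fun n => F y (n + 1)

/-- The number of occurrences of the instruction `i` among the first `k` ones. -/
def occ (i : Instruction) (w : ℕ → Instruction) (k : ℕ) : ℕ := Nat.count (fun n => w n = i) k

@[simp] theorem occ_zero (i : Instruction) (w : ℕ → Instruction) : occ i w 0 = 0 := by
  simp [occ]

theorem occ_succ (i : Instruction) (w : ℕ → Instruction) (k : ℕ) :
    occ i w (k + 1) = occ i w k + if w k = i then 1 else 0 := by
  simp [occ, Nat.count_succ]

theorem occ_succ' (i : Instruction) (w : ℕ → Instruction) (k : ℕ) :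
    occ i w (k + 1) = occ i (fun n => w (n + 1)) k + if w 0 = i then 1 else 0 := by
  simp [occ, Nat.count_succ']

theorem occ_mono (i : Instruction) (w : ℕ → Instruction) : Monotone (occ i w) :=
  Nat.count_monotone _

open Classical in
/-- `1` if the two states differ, and `0` otherwise. -/
def change (a b : SiteState) : ℕ := if a = b then 0 else 1

theorem change_le_one (a b : SiteState) : change a b ≤ 1 := by
  unfold change
  split_ifs <;> simp

@[simp] theorem change_self (a : SiteState) : change a a = 0 := by
  simp [change]

/-- `Reach x F η c`: following the instructions of `F`, there is a sequence of legal topplings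
from `η` during which the state of `x` changes at least `c` times. -/
inductive Reach (x : ℤ) : Field → FinConfig → ℕ → Prop
  | zero (F : Field) (η : FinConfig) : Reach x F η 0
  | step (F : Field) (η : FinConfig) (y : ℤ) (c : ℕ) (hy : (η y).active ≠ 0)
      (h : Reach x (shiftAt y F) (topple y (F y 0) η)
        (c - change (η x) (topple y (F y 0) η x))) : Reach x F η c

/-- The number of particles that jump to `y` when `h` instructions are performed. -/
def inflow (F : Field) (h : ℤ → ℕ) (y : ℤ) : ℕ :=
  occ (some 1) (F (y - 1)) (h (y - 1)) + occ (some (-1)) (F (y + 1)) (h (y + 1))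

/-- The number of particles that jump out of `y` when `h` instructions are performed. -/
def outflow (F : Field) (h : ℤ → ℕ) (y : ℤ) : ℕ :=
  occ (some 1) (F y) (h y) + occ (some (-1)) (F y) (h y)

/-- No particle outside of `V` ever jumps to `V`. -/
def Closed (F : Field) (V : Set ℤ) : Prop :=
  ∀ y ∉ V, (y + 1 ∈ V → ∀ n, F y n ≠ some 1) ∧ (y - 1 ∈ V → ∀ n, F y n ≠ some (-1))

/-- The site `y` is stable after `h` instructions have been performed. -/
def StableAt (F : Field) (η : FinConfig) (h : ℤ → ℕ) (y : ℤ) : Prop :=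
  (η y).particles + inflow F h y ≤ outflow F h y ∨
  ((η y).particles + inflow F h y ≤ outflow F h y + 1 ∧ 0 < h y ∧ F y (h y - 1) = none) ∨
  (h y = 0 ∧ η y = .rho ∧ inflow F h y = 0)

/-- All instructions are sleep attempts or jumps to a nearest neighbour. -/
def NearestNeighbour (F : Field) : Prop :=
  ∀ y n, F y n = none ∨ F y n = some 1 ∨ F y n = some (-1)

theorem NearestNeighbour.shiftAt {F : Field} (hF : NearestNeighbour F) (y : ℤ) :
    NearestNeighbour (shiftAt y F) := by
  intro z n
  by_cases h : z = y
  · subst h; simpa [ARW.shiftAt] using hF z (n + 1)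
  · simpa [ARW.shiftAt, h] using hF z n

theorem Closed.shiftAt {F : Field} {V : Set ℤ} (hF : Closed F V) (y : ℤ) :
    Closed (shiftAt y F) V := by
  intro z hz
  by_cases h : z = y
  · subst h
    exact ⟨fun h1 n => by simpa [ARW.shiftAt] using (hF z hz).1 h1 (n + 1),
      fun h1 n => by simpa [ARW.shiftAt] using (hF z hz).2 h1 (n + 1)⟩
  · exact ⟨fun h1 n => by simpa [ARW.shiftAt, h] using (hF z hz).1 h1 n,
      fun h1 n => by simpa [ARW.shiftAt, h] using (hF z hz).2 h1 n⟩

/-! ### Particle balance and the least action principle. -/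

theorem SiteState.particles_addOne (s : SiteState) : s.addOne.particles = s.particles + 1 := by
  cases s <;> rfl

theorem SiteState.particles_sleep (s : SiteState) : s.sleep.particles = s.particles := by
  rcases s with ⟨_ | _ | n⟩ | _ <;> rfl

theorem SiteState.particles_subOne {s : SiteState} (h : s.active ≠ 0) :
    s.subOne.particles + 1 = s.particles := by
  rcases s with ⟨_ | n⟩ | _ <;> simp_all [active, subOne, particles]

theorem SiteState.active_le_particles (s : SiteState) : s.active ≤ s.particles := by
  cases s <;> simp [active, particles]

theorem topple_none (y z : ℤ) (η : FinConfig) :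
    topple y none η z = if z = y then (η y).sleep else η z := by
  classical
  simp [topple, Function.update_apply]

theorem topple_some (y d z : ℤ) (hd : d ≠ 0) (η : FinConfig) :
    topple y (some d) η z =
      if z = y then (η y).subOne else if z = y + d then (η z).addOne else η z := by
  classical
  simp only [topple, Finsupp.coe_update, Function.update_apply]
  split_ifs <;> first | rfl | omega | simp_all

/-- The effect of performing one instruction at `y` on the number of occurrences. -/
theorem occ_shiftAt (i : Instruction) (F : Field) (h : ℤ → ℕ) (y z : ℤ) (hy : 0 < h y) :
    occ i (shiftAt y F z) (Function.update h y (h y - 1) z) +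
      (if z = y ∧ F y 0 = i then 1 else 0) = occ i (F z) (h z) := by
  by_cases hz : z = y
  · subst hz
    obtain ⟨k, hk⟩ := Nat.exists_eq_succ_of_ne_zero hy.ne'
    simp [shiftAt, hk, occ_succ']
  · simp [shiftAt, hz]

theorem occ_eq_zero {i : Instruction} {w : ℕ → Instruction} (h : ∀ n, w n ≠ i) (k : ℕ) :
    occ i w k = 0 := by
  induction k with
  | zero => simp
  | succ k ih => simp [occ_succ, ih, h k]

/-- At a site `y` outside `V` the value `h y` may be `0`, so that `h y - 1` truncates. This is
harmless, because no instruction of such a site points into `V`. -/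
theorem inflow_shiftAt {F : Field} {V : Set ℤ} (hV : Closed F V) (h : ℤ → ℕ) {y z : ℤ}
    (hz : z ∈ V) (hy : y ∈ V → 0 < h y) :
    inflow (shiftAt y F) (Function.update h y (h y - 1)) z +
      ((if z = y + 1 ∧ F y 0 = some 1 then 1 else 0) +
        (if z = y - 1 ∧ F y 0 = some (-1) then 1 else 0)) = inflow F h z := by
  have key : ∀ (i : Instruction) (u : ℤ), (u = y → y ∉ V → ∀ n, F y n ≠ i) →
      occ i (shiftAt y F u) (Function.update h y (h y - 1) u) +
        (if u = y ∧ F y 0 = i then 1 else 0) = occ i (F u) (h u) := by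
    intro i u hu
    by_cases hyV : 0 < h y
    · exact occ_shiftAt i F h y u hyV
    by_cases huy : u = y
    · have h0 := hu huy fun hm => hyV (hy hm)
      subst huy
      rw [occ_eq_zero h0, occ_eq_zero fun n => by simpa [shiftAt] using h0 (n + 1)]
      simp [h0 0]
    · simp [huy, shiftAt]
  have h1 := key (some 1) (z - 1) fun hu hyV => (hV y hyV).1 (by rwa [← hu, sub_add_cancel])
  have h2 := key (some (-1)) (z + 1) fun hu hyV => (hV y hyV).2 (by rwa [← hu, add_sub_cancel_right])
  have e1 : z - 1 = y ↔ z = y + 1 := by omega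
  have e2 : z + 1 = y ↔ z = y - 1 := by omega
  simp only [e1] at h1
  simp only [e2] at h2
  simp only [inflow]
  omega

theorem outflow_shiftAt (F : Field) (h : ℤ → ℕ) {y z : ℤ} (hy : z = y → 0 < h y) :
    outflow (shiftAt y F) (Function.update h y (h y - 1)) z +
      ((if z = y ∧ F y 0 = some 1 then 1 else 0) +
        (if z = y ∧ F y 0 = some (-1) then 1 else 0)) = outflow F h z := by
  by_cases hz : z = y
  · have h1 := occ_shiftAt (some 1) F h y z (hy hz)
    have h2 := occ_shiftAt (some (-1)) F h y z (hy hz)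
    simp only [outflow]
    omega
  · simp [outflow, shiftAt, hz]

/-- An active particle must be dealt with, so a legal toppling at a stable site always uses up an
instruction that `h` has counted. -/
theorem StableAt.pos {F : Field} {η : FinConfig} {h : ℤ → ℕ} {y : ℤ} (hs : StableAt F η h y)
    (hy : (η y).active ≠ 0) : 0 < h y := by
  by_contra h0
  have h0 : h y = 0 := by omega
  have := (η y).active_le_particles
  rcases hs with hs | hs | hs
  · simp only [outflow, h0, occ_zero] at hs
    omega
  · omega
  · rw [hs.2.1] at hy
    exact hy rfl

/-- A legal toppling preserves the stability of the remaining instructions. -/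
theorem StableAt.topple {F : Field} {V : Set ℤ} (hF : NearestNeighbour F) (hV : Closed F V)
    {η : FinConfig} {h : ℤ → ℕ} {y z : ℤ} (hy : (η y).active ≠ 0) (hyV : y ∈ V → 0 < h y)
    (hz : z ∈ V) (hs : StableAt F η h z) :
    StableAt (shiftAt y F) (topple y (F y 0) η) (Function.update h y (h y - 1)) z := by
  have hin := inflow_shiftAt hV h hz hyV
  have hout := outflow_shiftAt F h (y := y) (z := z) fun e => hyV (e ▸ hz)
  have hpos := hs.pos
  by_cases hzy : z = y
  · subst hzy
    have e1 : z ≠ z + 1 := by omega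
    have e2 : z ≠ z - 1 := by omega
    simp only [e1, e2, false_and, if_false, add_zero, true_and] at hin hout
    have hpart : (ARW.topple z (F z 0) η z).particles +
        ((if F z 0 = some 1 then 1 else 0) + (if F z 0 = some (-1) then 1 else 0)) =
        (η z).particles := by
      rcases hF z 0 with h0 | h0 | h0 <;> rw [h0]
      · simp [topple_none, SiteState.particles_sleep]
      · simpa [topple_some] using SiteState.particles_subOne hy
      · simpa [topple_some] using SiteState.particles_subOne hy
    rcases hs with hs | ⟨hs, h1, h2⟩ | hs
    · left; omega
    -- If the sleep attempt is the only instruction left, there is no outflow, so the balance allows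
    -- exactly one particle and no inflow. The particle falls asleep, which is the purpose of the
    -- third alternative of `StableAt`.
    · by_cases hk : h z = 1
      · right; right
        have h0 : F z 0 = none := by simpa [hk] using h2
        have hle := (η z).active_le_particles
        simp only [h0, reduceCtorEq, if_false, add_zero] at hin hout hpart
        have ho : outflow F h z = 0 := by simp [outflow, hk, occ_succ, h0]
        refine ⟨by simp [hk], ?_, by omega⟩
        have hp : (η z).particles = 1 := by omega
        rw [h0, topple_none, if_pos rfl]
        rcases hη : η z with n | _
        · rw [hη] at hp
          simp only [SiteState.particles] at hp
          subst hp
          rfl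
        · rfl
      · right; left
        refine ⟨by omega, by simp; omega, ?_⟩
        simp only [shiftAt, Function.update_self]
        rw [← h2]
        congr 1
        omega
    · rw [hs.2.1] at hy
      exact absurd rfl hy
  · simp only [hzy, false_and, if_false, add_zero] at hout
    have hpart : (ARW.topple y (F y 0) η z).particles =
        (η z).particles + ((if z = y + 1 ∧ F y 0 = some 1 then 1 else 0) +
        (if z = y - 1 ∧ F y 0 = some (-1) then 1 else 0)) := by
      rcases hF y 0 with h0 | h0 | h0 <;> rw [h0]
      · simp [topple_none, hzy]
      · rw [topple_some _ _ _ (by norm_num)]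
        by_cases h1 : z = y + 1 <;> simp [hzy, h1, SiteState.particles_addOne]
      · rw [topple_some _ _ _ (by norm_num), ← sub_eq_add_neg]
        by_cases h1 : z = y - 1 <;> simp [hzy, h1, SiteState.particles_addOne]
    rcases hs with hs | ⟨hs, h1, h2⟩ | ⟨hs, h1, h2⟩
    · left; omega
    · right; left
      refine ⟨by omega, by simpa [hzy] using h1, by simpa [hzy, shiftAt] using h2⟩
    · right; right
      refine ⟨by simpa [hzy] using hs, ?_, by omega⟩
      -- With zero inflow, no jump can wake the sleeping particle.
      have hA : ¬ (z = y + 1 ∧ F y 0 = some 1) := by intro hc; rw [if_pos hc] at hin; omega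
      have hB : ¬ (z = y - 1 ∧ F y 0 = some (-1)) := by intro hc; rw [if_pos hc] at hin; omega
      rcases hF y 0 with h0 | h0 | h0 <;> rw [h0]
      · simpa [topple_none, hzy] using h1
      · rw [topple_some _ _ _ (by norm_num)]
        rw [if_neg hzy, if_neg fun hc => hA ⟨hc, h0⟩, h1]
      · rw [topple_some _ _ _ (by norm_num), ← sub_eq_add_neg]
        rw [if_neg hzy, if_neg fun hc => hB ⟨hc, h0⟩, h1]

/-- Least action principle: stable instruction numbers bound the number of changes at a site during
any sequence of legal topplings. -/
theorem Reach.le_of_stable {x : ℤ} {F : Field} {η : FinConfig} {c : ℕ} (hr : Reach x F η c)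
    {V : Set ℤ} (hx : x ∈ V) (hF : NearestNeighbour F) (hV : Closed F V) {h : ℤ → ℕ}
    (hs : ∀ y ∈ V, StableAt F η h y) : c ≤ h x + inflow F h x := by
  induction hr generalizing h with
  | zero => simp
  | step F η y c hy _ ih =>
    have hyV : y ∈ V → 0 < h y := fun hm => (hs y hm).pos hy
    have h1 := ih (hF.shiftAt y) (hV.shiftAt y) fun z hz => (hs z hz).topple hF hV hy hyV hz
    have hin := inflow_shiftAt hV h hx hyV
    -- A change at `x` is charged to `h x` if `x` topples, and to the inflow if a particle arrives.
    by_cases hxy : x = y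
    · subst hxy
      have := hyV hx
      have := change_le_one (η x) (topple x (F x 0) η x)
      simp only [Function.update_self] at h1
      omega
    · simp only [Function.update_of_ne hxy] at h1
      suffices change (η x) (topple y (F y 0) η x) ≤
          (if x = y + 1 ∧ F y 0 = some 1 then 1 else 0) +
          (if x = y - 1 ∧ F y 0 = some (-1) then 1 else 0) by omega
      rcases hF y 0 with h0 | h0 | h0 <;> rw [h0]
      · simp [topple_none, hxy, change]
      · rw [topple_some _ _ _ (by norm_num)]
        simp only [hxy, if_false]
        by_cases h2 : x = y + 1
        · simpa [h2] using change_le_one _ _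
        · simp [h2]
      · rw [topple_some _ _ _ (by norm_num), ← sub_eq_add_neg]
        simp only [hxy, if_false]
        by_cases h2 : x = y - 1
        · simpa [h2] using change_le_one _ _
        · simp [h2]

/-- Stability bounds the inflow by the outflow plus one, and each instruction at `x` emits at most
one particle. -/
theorem Reach.le_of_stable' {x : ℤ} {F : Field} {η : FinConfig} {c : ℕ} (hr : Reach x F η c)
    {V : Set ℤ} (hx : x ∈ V) (hF : NearestNeighbour F) (hV : Closed F V) {h : ℤ → ℕ}
    (hs : ∀ y ∈ V, StableAt F η h y) : c ≤ 2 * h x + 1 := by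
  have h1 := hr.le_of_stable hx hF hV hs
  have h2 : ∀ k, occ (some 1) (F x) k + occ (some (-1)) (F x) k ≤ k := by
    intro k
    induction k with
    | zero => simp
    | succ k ih =>
      rw [occ_succ, occ_succ]
      split_ifs with h3 h4
      · simp [h3] at h4
      all_goals omega
  have h3 := h2 (h x)
  have h4 : outflow F h x = occ (some 1) (F x) (h x) + occ (some (-1)) (F x) (h x) := rfl
  rcases hs x hx with h | h | h <;> omega

/-! ### Product measures and fresh instructions. -/

/-- Instructions form a countable set, with the discrete σ-algebra. -/
instance : MeasurableSpace Instruction := ⊤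

instance : DiscreteMeasurableSpace Instruction := ⟨fun _ => trivial⟩

/-- Resampling one coordinate preserves a product measure. -/
theorem measurePreserving_update {ι : Type*} [DecidableEq ι] {X : Type*} [MeasurableSpace X]
    (ν : Measure X) [IsProbabilityMeasure ν] (k : ι) :
    MeasurePreserving (fun q : (ι → X) × X => Function.update q.1 k q.2)
      ((Measure.infinitePi fun _ : ι => ν).prod ν) (Measure.infinitePi fun _ : ι => ν) := by
  have hm : Measurable fun q : (ι → X) × X => Function.update q.1 k q.2 := by
    refine measurable_pi_lambda _ fun j => ?_
    by_cases h : j = k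
    · subst h; simpa using measurable_snd
    · simp only [ne_eq, h, not_false_eq_true, Function.update_of_ne]
      fun_prop
  refine ⟨hm, Measure.eq_infinitePi _ fun s t ht => ?_⟩
  rw [Measure.map_apply hm (MeasurableSet.pi s.countable_toSet fun i _ => ht i)]
  by_cases hk : k ∈ s
  · have : (fun q : (ι → X) × X => Function.update q.1 k q.2) ⁻¹' (s : Set ι).pi t =
        ((s.erase k : Finset ι) : Set ι).pi t ×ˢ t k := by
      ext ⟨F, y⟩
      simp only [Set.mem_preimage, Set.mem_pi, Set.mem_prod, Finset.mem_coe, Finset.mem_erase]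
      refine ⟨fun h => ⟨fun j hj => by simpa [hj.1] using h j hj.2, by simpa using h k hk⟩,
        fun h j hj => ?_⟩
      by_cases hjk : j = k
      · subst hjk; simpa using h.2
      · simpa [hjk] using h.1 j ⟨hjk, hj⟩
    rw [this, Measure.prod_prod, Measure.infinitePi_pi _ fun i _ => ht i,
      Finset.prod_erase_mul _ _ hk]
  · have : (fun q : (ι → X) × X => Function.update q.1 k q.2) ⁻¹' (s : Set ι).pi t =
        (s : Set ι).pi t ×ˢ Set.univ := by
      ext ⟨F, y⟩
      simp only [Set.mem_preimage, Set.mem_pi, Set.mem_prod, Finset.mem_coe, Set.mem_univ, and_true]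
      refine forall₂_congr fun j hj => ?_
      rw [Function.update_of_ne fun h : j = k => hk (h ▸ hj)]
    rw [this, Measure.prod_prod, Measure.infinitePi_pi _ fun i _ => ht i, measure_univ, mul_one]

/-- Put an element in front of a sequence. -/
def seqCons {X : Type*} (a : X) (w : ℕ → X) : ℕ → X := fun n => n.casesOn a w

theorem measurePreserving_seqCons {X : Type*} [MeasurableSpace X] (ν : Measure X)
    [IsProbabilityMeasure ν] :
    MeasurePreserving (fun q : X × (ℕ → X) => seqCons q.1 q.2)
      (ν.prod (Measure.infinitePi fun _ : ℕ => ν)) (Measure.infinitePi fun _ : ℕ => ν) := by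
  have hm : Measurable fun q : X × (ℕ → X) => seqCons q.1 q.2 := by
    refine measurable_pi_lambda _ fun j => ?_
    cases j with
    | zero => exact measurable_fst
    | succ j => exact (measurable_pi_apply j).comp measurable_snd
  refine ⟨hm, Measure.eq_infinitePi _ fun s t ht => ?_⟩
  rw [Measure.map_apply hm (MeasurableSet.pi s.countable_toSet fun i _ => ht i)]
  have hprod : ∏ i ∈ s.preimage Nat.succ Nat.succ_injective.injOn, ν (t (i + 1)) =
      ∏ i ∈ s.erase 0, ν (t i) := by
    refine Finset.prod_nbij Nat.succ ?_ Nat.succ_injective.injOn ?_ fun _ _ => rfl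
    · intro a ha
      simpa using ha
    · intro b hb
      obtain ⟨h0, hb⟩ : b ≠ 0 ∧ b ∈ s := by simpa [and_comm] using hb
      obtain ⟨a, rfl⟩ := Nat.exists_eq_succ_of_ne_zero h0
      exact ⟨a, by simpa using hb, rfl⟩
  have key : (fun q : X × (ℕ → X) => seqCons q.1 q.2) ⁻¹' (s : Set ℕ).pi t =
      {a | 0 ∈ s → a ∈ t 0} ×ˢ
        ((s.preimage Nat.succ Nat.succ_injective.injOn : Finset ℕ) : Set ℕ).pi
          fun i => t (i + 1) := by
    ext ⟨a, w⟩
    simp only [Set.mem_preimage, Set.mem_pi, Set.mem_prod, Finset.mem_coe, Finset.mem_preimage,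
      Set.mem_ofPred_eq]
    refine ⟨fun h => ⟨fun h0 => h 0 h0, fun i hi => h (i + 1) hi⟩, fun h i hi => ?_⟩
    cases i with
    | zero => exact h.1 hi
    | succ i => exact h.2 i hi
  rw [key, Measure.prod_prod, Measure.infinitePi_pi _ fun i _ => ht (i + 1), hprod]
  by_cases h0 : 0 ∈ s
  · simp only [h0, forall_const, Set.ofPred_mem_eq]
    exact Finset.mul_prod_erase s (fun i => ν (t i)) h0
  · simp [h0]

/-- The law of independent stacks of independent instructions. -/
def stackLaw (r : PMF Instruction) : Measure (ℕ → Instruction) :=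
  Measure.infinitePi fun _ : ℕ => r.toMeasure

instance (r : PMF Instruction) : IsProbabilityMeasure (stackLaw r) := by
  unfold stackLaw; infer_instance

/-- The law of independent stacks of independent instructions, one stack at each site. -/
def fieldLaw (r : PMF Instruction) : Measure Field := Measure.infinitePi fun _ : ℤ => stackLaw r

instance (r : PMF Instruction) : IsProbabilityMeasure (fieldLaw r) := by
  unfold fieldLaw; infer_instance

/-- Put an instruction in front of the stack at `y`. -/
def consAt (y : ℤ) (i : Instruction) (F : Field) : Field :=
  Function.update F y (seqCons i (F y))

theorem shiftAt_consAt (y : ℤ) (i : Instruction) (F : Field) : shiftAt y (consAt y i F) = F := by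
  simp [shiftAt, consAt, seqCons]

theorem consAt_apply_zero (y : ℤ) (i : Instruction) (F : Field) : consAt y i F y 0 = i := by
  simp [consAt, seqCons]

theorem measurePreserving_consAt (r : PMF Instruction) (y : ℤ) :
    MeasurePreserving (fun q : Instruction × Field => consAt y q.1 q.2)
      (r.toMeasure.prod (fieldLaw r)) (fieldLaw r) := by
  have hU : MeasurePreserving (fun q : Field × (ℕ → Instruction) => Function.update q.1 y q.2)
      ((fieldLaw r).prod (stackLaw r)) (fieldLaw r) := measurePreserving_update (stackLaw r) y
  have hC : MeasurePreserving (fun q : Instruction × (ℕ → Instruction) => seqCons q.1 q.2)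
      (r.toMeasure.prod (stackLaw r)) (stackLaw r) := measurePreserving_seqCons r.toMeasure
  have hm : Measurable fun q : Instruction × Field => consAt y q.1 q.2 := by
    have h1 : Measurable fun q : Instruction × Field => (q.2, seqCons q.1 (q.2 y)) :=
      measurable_snd.prodMk (hC.measurable.comp
        (measurable_fst.prodMk ((measurable_pi_apply y).comp measurable_snd)))
    exact hU.measurable.comp h1
  have hIU := (MeasurePreserving.id r.toMeasure).prod hU
  have hassoc := measurePreserving_prodAssoc r.toMeasure (fieldLaw r) (stackLaw r)
  have hassoc' := measurePreserving_prodAssoc (fieldLaw r) r.toMeasure (stackLaw r)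
  have hswap := (Measure.measurePreserving_swap (μ := r.toMeasure) (ν := fieldLaw r)).prod
    (MeasurePreserving.id (stackLaw r))
  have hcomp := hU.comp (((MeasurePreserving.id (fieldLaw r)).prod hC).comp
    (hassoc'.comp (hswap.comp (hassoc.symm _))))
  refine ⟨hm, ?_⟩
  -- Replace the stack at `y` by an independent copy `w`. Putting `i` in front of `w` and then
  -- overwriting the stack at `y` is a composition of measure-preserving maps.
  conv_lhs => rw [← hIU.map_eq]
  rw [Measure.map_map hm hIU.measurable]
  refine Eq.trans (congrArg (fun f => Measure.map f _) ?_) hcomp.map_eq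
  ext1 ⟨i, F, w⟩
  simp [consAt, MeasurableEquiv.prodAssoc]

/-- If putting `i` in front of the stack at `y` sends `S i` to `S₀` for all `i`, then the average
measure of `S i` is at most the measure of `S₀`. -/
theorem lintegral_fieldLaw_le (r : PMF Instruction) (y : ℤ) (S : Instruction → Set Field)
    (S₀ : Set Field) (h : ∀ i, ∀ F ∈ S i, consAt y i F ∈ S₀) :
    ∫⁻ i, fieldLaw r (S i) ∂r.toMeasure ≤ fieldLaw r S₀ := by
  have hmp := measurePreserving_consAt r y
  -- No measurability is assumed, so `S₀` is replaced by a measurable hull.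
  have hT := measurableSet_toMeasurable (fieldLaw r) S₀
  rw [← measure_toMeasurable S₀, ← hmp.measure_preimage hT.nullMeasurableSet,
    Measure.prod_apply (hmp.measurable hT)]
  exact lintegral_mono fun i => measure_mono fun F hF => subset_toMeasurable _ _ (h i F hF)

theorem lintegral_toMeasure_bind {α β : Type*} [MeasurableSpace β] [Countable β]
    [DiscreteMeasurableSpace β] (q : PMF α) (f : α → PMF β) (φ : β → ℝ≥0∞) :
    ∫⁻ b, φ b ∂(q.bind f).toMeasure = ∑' a, q a * ∫⁻ b, φ b ∂(f a).toMeasure := by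
  simp only [lintegral_countable', PMF.toMeasure_apply_singleton _ _ (MeasurableSet.singleton _),
    PMF.bind_apply, ← ENNReal.tsum_mul_left]
  rw [ENNReal.tsum_comm]
  exact tsum_congr fun a => tsum_congr fun b => by ring

/-! ### The reaching probability along the jump chain. -/

/-- The probability that the instructions allow for `c` changes at `x` by legal topplings. -/
def reachProb (r : PMF Instruction) (x : ℤ) (η : FinConfig) (c : ℕ) : ℝ≥0∞ :=
  fieldLaw r {F | Reach x F η c}

theorem reachProb_zero (r : PMF Instruction) (x : ℤ) (η : FinConfig) : reachProb r x η 0 = 1 := by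
  rw [reachProb, show {F | Reach x F η 0} = Set.univ from Set.eq_univ_of_forall fun F => .zero F η,
    measure_univ]

/-- The reaching probability is superharmonic for the jump chain. -/
theorem lintegral_step_le (lam : ℝ≥0) (p : PMF ℤ) (x : ℤ) (η : FinConfig) (c : ℕ) :
    ∫⁻ ξ, reachProb (instructionLaw lam p) x ξ (c - change (η x) (ξ x)) ∂(step lam p η).toMeasure ≤
      reachProb (instructionLaw lam p) x η c := by
  unfold step
  split_ifs with h
  · rw [PMF.toMeasure_pure, lintegral_dirac]
    simp
  rw [lintegral_toMeasure_bind]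
  calc _ ≤ ∑' y, ringingSite η h y * reachProb (instructionLaw lam p) x η c := by
        refine ENNReal.tsum_le_tsum fun y => ?_
        by_cases hy : (η y).active = 0
        · have : ringingSite η h y = 0 := by
            rw [ringingSite, PMF.normalize_apply, hy]
            simp
          simp [this]
        gcongr
        rw [← PMF.toMeasure_map _ _ Measurable.of_discrete,
          lintegral_map Measurable.of_discrete Measurable.of_discrete]
        -- The instruction drawn by the chain plays the role of the first one in the stack at `y`.
        refine lintegral_fieldLaw_le _ y _ _ fun i F hF => ?_
        refine Reach.step _ _ y _ hy ?_
        rwa [shiftAt_consAt, consAt_apply_zero]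
    _ = _ := by rw [ENNReal.tsum_mul_right, PMF.tsum_coe, one_mul]

/-- The number of changes at `x` during the first `k` steps. -/
def changes (x : ℤ) (ω : ℕ → FinConfig) (k : ℕ) : ℕ :=
  ∑ i ∈ Finset.range k, change (ω i x) (ω (i + 1) x)

theorem map_eval_zero_trajMeasure {X : Type*} [MeasurableSpace X]
    {κ : (n : ℕ) → Kernel (Finset.Iic n → X) X} [∀ n, IsMarkovKernel (κ n)]
    (μ₀ : Measure X) [IsProbabilityMeasure μ₀] :
    (Kernel.trajMeasure (X := fun _ : ℕ => X) μ₀ κ).map (fun ω => ω 0) = μ₀ := by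
  have h : (Kernel.trajMeasure (X := fun _ : ℕ => X) μ₀ κ).map (Preorder.frestrictLe 0) =
      μ₀.map (MeasurableEquiv.piUnique fun _ : Finset.Iic 0 => X).symm := by
    rw [Kernel.trajMeasure, Measure.map_comp _ _ (by fun_prop), Kernel.traj_map_frestrictLe,
      Kernel.partialTraj_self, Measure.id_comp]
  have h2 := congrArg (Measure.map fun w : Finset.Iic 0 → X => w ⟨0, by simp⟩) h
  rw [Measure.map_map (by fun_prop) (by fun_prop)] at h2
  refine h2.trans ?_
  rw [Measure.map_map (by fun_prop) (by fun_prop)]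
  exact Measure.map_id

/-- Lowering the target by the changes already made turns the superharmonicity of `reachProb` into a
supermartingale property. -/
theorem lintegral_trajMeasure_changes_le (lam : ℝ≥0) (p : PMF ℤ) (μ₀ : Measure FinConfig)
    [IsProbabilityMeasure μ₀] (x : ℤ) (c k : ℕ) :
    ∫⁻ ω, reachProb (instructionLaw lam p) x (ω k) (c - changes x ω k)
        ∂(Kernel.trajMeasure (X := fun _ : ℕ => FinConfig) μ₀ (stepKernel lam p)) ≤
      ∫⁻ η, reachProb (instructionLaw lam p) x η c ∂μ₀ := by
  set P := Kernel.trajMeasure (X := fun _ : ℕ => FinConfig) μ₀ (stepKernel lam p)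
  induction k with
  | zero =>
    have h := map_eval_zero_trajMeasure (X := FinConfig) (κ := stepKernel lam p) μ₀
    conv_rhs => rw [← h]
    rw [lintegral_map Measurable.of_discrete (measurable_pi_apply 0)]
    simp [changes, P]
  | succ k ih =>
    refine le_trans ?_ ih
    -- the changes up to time `k`, as a function of the past
    let cp : ((i : Finset.Iic k) → FinConfig) → ℕ := fun w => ∑ i ∈ (Finset.range k).attach,
      change (w ⟨i, Finset.mem_Iic.2 (Finset.mem_range.1 i.2).le⟩ x)
        (w ⟨i + 1, Finset.mem_Iic.2 (Finset.mem_range.1 i.2)⟩ x)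
    have hcp : ∀ ω : ℕ → FinConfig, cp (Preorder.frestrictLe k ω) = changes x ω k := by
      intro ω
      simp only [cp, changes]
      exact Finset.sum_attach (Finset.range k) fun i => change (ω i x) (ω (i + 1) x)
    have hcpm : Measurable cp := by
      refine Finset.measurable_sum _ fun i _ => ?_
      have h : Measurable fun w : (i : Finset.Iic k) → FinConfig =>
          (w ⟨i, Finset.mem_Iic.2 (Finset.mem_range.1 i.2).le⟩,
            w ⟨i + 1, Finset.mem_Iic.2 (Finset.mem_range.1 i.2)⟩) := by fun_prop
      exact (Measurable.of_discrete (f := fun q : FinConfig × FinConfig =>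
        change (q.1 x) (q.2 x))).comp h
    let last : ((i : Finset.Iic k) → FinConfig) → FinConfig :=
      fun w => w ⟨k, Finset.mem_Iic.mpr le_rfl⟩
    have hlast : Measurable last := measurable_pi_apply _
    let Φ : ((i : Finset.Iic k) → FinConfig) × FinConfig → ℝ≥0∞ := fun q =>
      reachProb (instructionLaw lam p) x q.2 (c - cp q.1 - change (last q.1 x) (q.2 x))
    have hΦ : Measurable Φ :=
      (Measurable.of_discrete (f := fun q : (FinConfig × FinConfig) × ℕ =>
        reachProb (instructionLaw lam p) x q.1.2 (c - q.2 - change (q.1.1 x) (q.1.2 x)))).comp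
        (((hlast.comp measurable_fst).prodMk measurable_snd).prodMk (hcpm.comp measurable_fst))
    have hmap := Kernel.map_frestrictLe_trajMeasure_compProd_eq_map_trajMeasure
      (X := fun _ : ℕ => FinConfig) (κ := stepKernel lam p) (μ₀ := μ₀) (a := k)
    have hr : Measurable (Preorder.frestrictLe (π := fun _ : ℕ => FinConfig) k) := by fun_prop
    calc _ = ∫⁻ ω, Φ (Preorder.frestrictLe k ω, ω (k + 1)) ∂P := by
          refine lintegral_congr fun ω => ?_
          simp only [Φ, hcp, changes, Finset.sum_range_succ, Nat.sub_sub]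
          rfl
      _ = ∫⁻ q, Φ q ∂(P.map (Preorder.frestrictLe k) ⊗ₘ stepKernel lam p k) := by
          rw [hmap, lintegral_map hΦ (by fun_prop)]
      _ = ∫⁻ ω, ∫⁻ ξ, Φ (Preorder.frestrictLe k ω, ξ)
            ∂stepKernel lam p k (Preorder.frestrictLe k ω) ∂P := by
          rw [Measure.lintegral_compProd hΦ, lintegral_map _ hr]
          exact hΦ.lintegral_kernel_prod_right'
      _ ≤ _ := by
          refine lintegral_mono fun ω => ?_
          simp only [Φ, hcp]
          exact lintegral_step_le lam p x (ω k) (c - changes x ω k)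

theorem measurable_changes (x : ℤ) (k : ℕ) :
    Measurable fun ω : ℕ → FinConfig => changes x ω k := by
  refine Finset.measurable_sum _ fun i _ => ?_
  have h : Measurable fun ω : ℕ → FinConfig => (ω i, ω (i + 1)) := by fun_prop
  exact (Measurable.of_discrete (f := fun q : FinConfig × FinConfig =>
    change (q.1 x) (q.2 x))).comp h

theorem changes_mono (x : ℤ) (ω : ℕ → FinConfig) : Monotone (changes x ω) := fun _ _ h =>
  Finset.sum_le_sum_of_subset (Finset.range_mono h)

theorem measurable_truncate (n : ℕ) : Measurable (truncate n) := by
  refine measurable_to_countable' fun ξ => ?_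
  have h : truncate n ⁻¹' {ξ} =
      ⋂ y : ℤ, {ζ | (if y ∈ Finset.Icc (-(n : ℤ)) n then SiteState.num (ζ y) else 0) = ξ y} := by
    ext ζ
    simp only [Set.mem_preimage, Set.mem_singleton_iff, Finsupp.ext_iff, Set.mem_iInter]
    rfl
  rw [h]
  refine MeasurableSet.iInter fun y => ?_
  exact (measurable_pi_apply (X := fun _ : ℤ => ℕ) y) (MeasurableSet.of_discrete (s := {m : ℕ |
    (if y ∈ Finset.Icc (-(n : ℤ)) n then SiteState.num m else 0) = ξ y}))

instance (μ : ℝ≥0) (n : ℕ) : IsProbabilityMeasure (initialLaw μ n) :=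
  Measure.isProbabilityMeasure_map (measurable_truncate n).aemeasurable

instance (lam : ℝ≥0) (p : PMF ℤ) (μ : ℝ≥0) (n : ℕ) : IsProbabilityMeasure (finLaw lam p μ n) := by
  have := isProbabilityMeasure_expMeasure (r := 1) one_pos
  unfold finLaw
  infer_instance

/-- The number of changes at `x` in a finite system is controlled by the instructions. -/
theorem finLaw_changes_le (lam : ℝ≥0) (p : PMF ℤ) (μ : ℝ≥0) (n : ℕ) (x : ℤ) (c : ℕ) :
    finLaw lam p μ n {ω | ∃ k, c ≤ changes x ω.1 k} ≤
      ∫⁻ ζ, reachProb (instructionLaw lam p) x (truncate n ζ) c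
        ∂(Measure.infinitePi fun _ : ℤ => poissonMeasure μ) := by
  have hset : {ω : FinSample | ∃ k, c ≤ changes x ω.1 k} =
      (⋃ k, {ω : ℕ → FinConfig | c ≤ changes x ω k}) ×ˢ Set.univ := by
    ext ω; simp
  have := isProbabilityMeasure_expMeasure (r := 1) one_pos
  rw [hset, finLaw, Measure.prod_prod, measure_univ, mul_one, Monotone.measure_iUnion]
  · refine iSup_le fun k => ?_
    refine le_trans ?_ ((lintegral_trajMeasure_changes_le lam p (initialLaw μ n) x c k).trans ?_)
    · have hk : MeasurableSet {ω | c ≤ changes x ω k} := (measurable_changes x k) measurableSet_Ici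
      rw [← lintegral_indicator_one hk]
      refine lintegral_mono fun ω => ?_
      refine Set.indicator_apply_le' (fun h => ?_) fun _ => zero_le
      -- After `c` changes the target is `0`, where the reaching probability is `1`.
      rw [Nat.sub_eq_zero_of_le (Set.mem_Ici.1 h), reachProb_zero]
      rfl
    · rw [initialLaw, lintegral_map Measurable.of_discrete (measurable_truncate n)]
  · exact fun i j hij ω (h : c ≤ _) => h.trans (changes_mono x ω hij)

/-! ### From tightness to local fixation. -/

/-- Along increasing elements of `S`, the function `f` changes at least `K` times. -/
def ChangesOn {T α : Type*} [LinearOrder T] (f : T → α) (S : Set T) (K : ℕ) : Prop :=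
  ∃ t : ℕ → T, (∀ i ≤ K, t i ∈ S) ∧ ∀ i < K, t i < t (i + 1) ∧ f (t i) ≠ f (t (i + 1))

theorem ChangesOn.mono {T α : Type*} [LinearOrder T] {f : T → α} {S S' : Set T} {K : ℕ}
    (h : ChangesOn f S K) (hS : S ⊆ S') : ChangesOn f S' K :=
  let ⟨t, h1, h2⟩ := h
  ⟨t, fun i hi => hS (h1 i hi), h2⟩

/-- A right-continuous function with finitely many changes along a dense set is eventually
constant. -/
theorem eventually_const_of_not_changesOn {α : Type*} {g : ℝ≥0 → α}
    (hg : ∀ t, ∀ᶠ s in 𝓝[>] t, g s = g t) {D : Set ℝ≥0} (hD : Dense D) {K : ℕ}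
    (hK : ¬ ChangesOn g D K) : ∃ a, ∀ᶠ t in atTop, g t = a := by
  classical
  have hex : ∃ K, ¬ ChangesOn g D K := ⟨K, hK⟩
  obtain ⟨d, hd⟩ := hD.nonempty
  obtain ⟨m, hm⟩ : ∃ m, Nat.find hex = m + 1 := by
    refine Nat.exists_eq_succ_of_ne_zero fun h0 => Nat.find_spec hex ?_
    rw [h0]
    exact ⟨fun _ => d, fun _ _ => hd, fun i hi => absurd hi (by omega)⟩
  obtain ⟨t, ht, htc⟩ : ChangesOn g D m := by
    by_contra hc
    have := Nat.find_min' hex hc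
    omega
  have hmn := Nat.find_spec hex
  rw [hm] at hmn
  -- `m` is the largest number of changes along `D`, so a later change would extend the sequence.
  have hconst : ∀ s ∈ D, t m < s → g s = g (t m) := by
    intro s hs hts
    by_contra hne
    refine hmn ⟨fun i => if i ≤ m then t i else s, fun i hi => ?_, fun i hi => ?_⟩
    · dsimp only
      split_ifs with h
      exacts [ht i h, hs]
    · rcases Nat.lt_succ_iff_lt_or_eq.1 hi with h | h
      · simpa [h.le, Nat.succ_le_of_lt h] using htc i h
      · subst h
        simpa using ⟨hts, fun h => hne h.symm⟩
  refine ⟨g (t m), (eventually_gt_atTop (t m)).mono fun s hs => ?_⟩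
  -- By right-continuity, `g s` is also the value at a point of `D` just after `s`.
  obtain ⟨u, hu, hsub⟩ := mem_nhdsGT_iff_exists_Ioo_subset.1 (hg s)
  obtain ⟨e, he, heu⟩ := hD.exists_between hu
  rw [← hconst e he (hs.trans heu.1)]
  exact (hsub heu).symm

theorem eq_of_changes_eq {x : ℤ} {ω : ℕ → FinConfig} {m n : ℕ} (hmn : m ≤ n)
    (h : changes x ω n = changes x ω m) : ω m x = ω n x := by
  induction n, hmn using Nat.le_induction with
  | base => rfl
  | succ n hmn ih =>
    have h1 := changes_mono x ω hmn
    have h2 : changes x ω (n + 1) = changes x ω n + change (ω n x) (ω (n + 1) x) := by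
      simp [changes, Finset.sum_range_succ]
    rw [ih (by omega)]
    by_contra hne
    have h3 : change (ω n x) (ω (n + 1) x) = 1 := by simp [change, hne]
    omega

theorem ChangesOn.le_changes {x : ℤ} {ω : ℕ → FinConfig} {K : ℕ}
    (h : ChangesOn (fun n => ω n x) Set.univ K) : ∃ k, K ≤ changes x ω k := by
  obtain ⟨t, -, ht⟩ := h
  have : ∀ i ≤ K, i ≤ changes x ω (t i) := by
    intro i
    induction i with
    | zero => simp
    | succ i ih =>
      intro hi
      have h1 := ih (by omega)
      obtain ⟨h2, h3⟩ := ht i (by omega)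
      have h4 := changes_mono x ω h2.le
      have h5 : changes x ω (t (i + 1)) ≠ changes x ω (t i) := fun h => h3 (eq_of_changes_eq h2.le h)
      omega
  exact ⟨t K, this K le_rfl⟩

/-- Changes of the state of `x` in continuous time are changes along the jump chain, with at most
one exception (due to the convention after an explosion). -/
theorem changesOn_of_finState {lam : ℝ≥0} {ω : FinSample} {x : ℤ} {S : Set ℝ≥0} {K : ℕ}
    (h : ChangesOn (fun t => finState lam ω t x) S (K + 1)) :
    ChangesOn (fun n => ω.1 n x) Set.univ K := by
  obtain ⟨t, -, ht⟩ := h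
  let A : ℝ≥0 → Set ℕ := fun t => {k : ℕ | (t : ℝ≥0∞) < ringTime lam ω (k + 1)}
  have hA : ∀ {s t}, s ≤ t → A t ⊆ A s := fun {s t} hst k hk =>
    lt_of_le_of_lt (ENNReal.coe_le_coe.2 hst) hk
  -- If `A (t i)` is empty, then so are all later ones, and `sInf ∅ = 0` freezes the state. Hence
  -- only the last time `t (K + 1)` can lie after an explosion.
  have hne : ∀ i ≤ K, (A (t i)).Nonempty := by
    intro i hi
    by_contra hc
    rw [Set.not_nonempty_iff_eq_empty] at hc
    obtain ⟨h1, h2⟩ := ht i (by omega)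
    have hc' : A (t (i + 1)) = ∅ := Set.subset_empty_iff.1 (hc ▸ hA h1.le)
    refine h2 ?_
    change ω.1 (sInf (A (t i))) x = ω.1 (sInf (A (t (i + 1)))) x
    rw [hc, hc']
  refine ⟨fun i => sInf (A (t i)), fun _ _ => trivial, fun i hi => ?_⟩
  obtain ⟨h1, h2⟩ := ht i (by omega)
  have hle : sInf (A (t i)) ≤ sInf (A (t (i + 1))) :=
    Nat.sInf_le (hA h1.le (Nat.sInf_mem (hne (i + 1) (by omega))))
  exact ⟨lt_of_le_of_ne hle fun h => h2 (by
    change ω.1 (sInf (A (t i))) x = ω.1 (sInf (A (t (i + 1)))) x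
    exact congrArg (fun k => ω.1 k x) h), h2⟩

theorem measurable_ringTime (lam : ℝ≥0) (k : ℕ) : Measurable fun ω => ringTime lam ω k := by
  refine Finset.measurable_sum _ fun i _ => ?_
  refine Measurable.div (by fun_prop) ?_
  exact (Measurable.of_discrete (f := fun η : FinConfig =>
    (((1 + lam) * (totalActive η : ℝ≥0) : ℝ≥0) : ℝ≥0∞))).comp (by fun_prop :
      Measurable fun ω : FinSample => ω.1 i)

theorem measurable_sInf_nat {Ω : Type*} [MeasurableSpace Ω] {A : Ω → Set ℕ}
    (hA : ∀ k, MeasurableSet {ω | k ∈ A ω}) : Measurable fun ω => sInf (A ω) := by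
  refine measurable_to_countable' fun k => ?_
  have h : (fun ω => sInf (A ω)) ⁻¹' {k} =
      ({ω | k ∈ A ω} ∩ ⋂ m ∈ Set.Iio k, {ω | m ∈ A ω}ᶜ) ∪
        ((⋂ m, {ω | m ∈ A ω}ᶜ) ∩ {_ω | k = 0}) := by
    ext ω
    simp only [Set.mem_preimage, Set.mem_singleton_iff, Set.mem_union, Set.mem_inter_iff,
      Set.mem_iInter, Set.mem_compl_iff, Set.mem_Iio, Set.mem_ofPred_eq]
    constructor
    · rintro rfl
      rcases (A ω).eq_empty_or_nonempty with h | h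
      · right; simp [h]
      · left; exact ⟨Nat.sInf_mem h, fun m hm => Nat.notMem_of_lt_sInf hm⟩
    · rintro (⟨h1, h2⟩ | ⟨h1, rfl⟩)
      · refine le_antisymm (Nat.sInf_le h1) (not_lt.1 fun h => h2 _ h (Nat.sInf_mem ⟨k, h1⟩))
      · rw [Set.eq_empty_of_forall_notMem h1, Nat.sInf_empty]
  rw [h]
  refine ((hA k).inter (MeasurableSet.biInter (Set.to_countable _) fun m _ => (hA m).compl)).union
    ((MeasurableSet.iInter fun m => (hA m).compl).inter (MeasurableSet.const _))

theorem measurable_finState (lam : ℝ≥0) (t : ℝ≥0) : Measurable fun ω => finState lam ω t := by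
  have hN : Measurable fun ω : FinSample =>
      sInf {k : ℕ | (t : ℝ≥0∞) < ringTime lam ω (k + 1)} :=
    measurable_sInf_nat fun k => measurableSet_lt measurable_const (measurable_ringTime lam (k + 1))
  have hev : Measurable fun q : (ℕ → FinConfig) × ℕ => q.1 q.2 :=
    measurable_from_prod_countable_left fun k => measurable_pi_apply k
  exact hev.comp (measurable_fst.prodMk hN)

/-- Events of finitely many coordinates have at most the limit of their finite volume
probabilities. -/
theorem IsProcess.measure_le {lam : ℝ≥0} {p : PMF ℤ} {μ : ℝ≥0} {Ω : Type u} [MeasurableSpace Ω]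
    {P : Measure Ω} {η : ℝ≥0 → Ω → ℤ → SiteState} (hη : IsProcess lam p μ P η)
    (S : Finset (ℝ≥0 × ℤ)) (A : Set (S → SiteState)) {ε : ℝ≥0∞}
    (hA : ∀ n, finLaw lam p μ n {ω | (fun i : S => finState lam ω i.1.1 i.1.2) ∈ A} ≤ ε) :
    P {ω | (fun i : S => η i.1.1 ω i.1.2) ∈ A} ≤ ε := by
  classical
  let cyl : (S → SiteState) → Set Ω := fun w => {ω | ∀ i : S, η i.1.1 ω i.1.2 = w i}
  let fcyl : (S → SiteState) → Set FinSample := fun w =>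
    {ω | ∀ i : S, finState lam ω i.1.1 i.1.2 = w i}
  have hlim : ∀ w, Tendsto (fun n => finLaw lam p μ n (fcyl w)) atTop (𝓝 (P (cyl w))) := by
    intro w
    have := hη.law S fun i => if h : i ∈ S then w ⟨i, h⟩ else 0
    convert this using 4 <;>
    · ext ω
      refine Subtype.forall.trans (forall₂_congr fun i hi => ?_)
      simp [hi]
  have hsub : {ω | (fun i : S => η i.1.1 ω i.1.2) ∈ A} ⊆ ⋃ w : A, cyl w := fun ω hω =>
    Set.mem_iUnion.2 ⟨⟨_, hω⟩, fun _ => rfl⟩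
  have hfsum : ∀ n, ∑' w : A, finLaw lam p μ n (fcyl w) ≤ ε := by
    intro n
    refine le_trans (le_of_eq ?_) (hA n)
    rw [← measure_iUnion]
    · congr 1
      ext ω
      simp only [Set.mem_iUnion, fcyl, Set.mem_ofPred_eq]
      constructor
      · rintro ⟨w, hw⟩
        have : (fun i : S => finState lam ω i.1.1 i.1.2) = w := funext hw
        rw [this]
        exact w.2
      · exact fun h => ⟨⟨_, h⟩, fun _ => rfl⟩
    · intro w w' hww
      refine Set.disjoint_left.2 fun ω h1 h2 => hww (Subtype.ext (funext fun i => ?_))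
      rw [← h1 i, h2 i]
    · intro w
      have : fcyl w = ⋂ i : S, {ω | finState lam ω i.1.1 i.1.2 = w.1 i} := by
        ext ω; simp [fcyl]
      rw [this]
      exact MeasurableSet.iInter fun i => (measurable_finState lam i.1.1)
        (MeasurableSet.of_discrete (s := {ξ : FinConfig | ξ i.1.2 = w.1 i}))
  calc _ ≤ ∑' w : A, P (cyl w) := (measure_mono hsub).trans (measure_iUnion_le _)
    -- The cylinders are countably many and each probability converges, so Fatou's lemma for the
    -- counting measure applies.
    _ = ∫⁻ w : A, liminf (fun n => finLaw lam p μ n (fcyl w)) atTop ∂Measure.count := by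
        rw [lintegral_count]
        exact tsum_congr fun w => ((hlim w).liminf_eq).symm
    _ ≤ liminf (fun n => ∫⁻ w : A, finLaw lam p μ n (fcyl w) ∂Measure.count) atTop :=
        lintegral_liminf_le fun n => Measurable.of_discrete
    _ ≤ ε := by
        simp only [lintegral_count]
        refine liminf_le_of_frequently_le' (Frequently.of_forall hfsum)

/-- If the number of changes at each site is tight, uniformly in the finite systems, then the
infinite system locally fixates. -/
theorem fixatesAS_of_tight {lam : ℝ≥0} {p : PMF ℤ} {μ : ℝ≥0}
    (h : ∀ x : ℤ, ∀ ε : ℝ≥0∞, 0 < ε → ∃ K, ∀ n,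
      finLaw lam p μ n {ω | ∃ k, K ≤ changes x ω.1 k} ≤ ε) : FixatesAS.{u} lam p μ := by
  intro Ω _ P _ η hη
  let D : Set ℝ≥0 := Set.range (TopologicalSpace.denseSeq ℝ≥0)
  have hD : Dense D := TopologicalSpace.denseRange_denseSeq ℝ≥0
  let Dm : ℕ → Finset ℝ≥0 := fun m => (Finset.range m).image (TopologicalSpace.denseSeq ℝ≥0)
  have hDm : Monotone Dm := fun i j hij => Finset.image_subset_image (Finset.range_mono hij)
  have hbound : ∀ x : ℤ, ∀ ε : ℝ≥0∞, 0 < ε →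
      ∃ K, P {ω | ChangesOn (fun t => η t ω x) D K} ≤ ε := by
    intro x ε hε
    obtain ⟨K, hK⟩ := h x ε hε
    -- One more change than `K`, to allow for the explosion convention in `changesOn_of_finState`.
    refine ⟨K + 1, ?_⟩
    have hsub : {ω | ChangesOn (fun t => η t ω x) D (K + 1)} ⊆
        ⋃ m, {ω | ChangesOn (fun t => η t ω x) (Dm m) (K + 1)} := by
      rintro ω ⟨t, ht, htc⟩
      have : ∀ i : ℕ, ∃ j, i ≤ K + 1 → TopologicalSpace.denseSeq ℝ≥0 j = t i := by
        intro i
        by_cases hi : i ≤ K + 1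
        · obtain ⟨j, hj⟩ := ht i hi
          exact ⟨j, fun _ => hj⟩
        · exact ⟨0, fun h => absurd h hi⟩
      choose j hj using this
      refine Set.mem_iUnion.2 ⟨(Finset.range (K + 2)).sup j + 1, t, fun i hi => ?_, htc⟩
      refine Finset.mem_coe.2 (Finset.mem_image.2 ⟨j i, ?_, hj i hi⟩)
      exact Finset.mem_range.2 (Nat.lt_succ_of_le
        (Finset.le_sup (f := j) (Finset.mem_range.2 (by omega))))
    refine (measure_mono hsub).trans ?_
    rw [Monotone.measure_iUnion]
    · refine iSup_le fun m => ?_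
      let S : Finset (ℝ≥0 × ℤ) := (Dm m) ×ˢ {x}
      have hS : ∀ t ∈ Dm m, (t, x) ∈ S := fun t ht => by simp [S, ht]
      let A : Set (S → SiteState) := {w | ChangesOn
        (fun t => if ht : t ∈ Dm m then w ⟨(t, x), hS t ht⟩ else 0) (Dm m : Set ℝ≥0) (K + 1)}
      have hconv : ∀ g : ℝ≥0 → SiteState,
          ChangesOn (fun t => if t ∈ Dm m then g t else 0) (Dm m : Set ℝ≥0) (K + 1) ↔
            ChangesOn g (Dm m : Set ℝ≥0) (K + 1) := by
        intro g
        refine exists_congr fun t => and_congr_right fun ht => forall₂_congr fun i hi => ?_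
        have h1 : t i ∈ Dm m := ht i hi.le
        have h2 : t (i + 1) ∈ Dm m := ht (i + 1) hi
        simp [h1, h2]
      have hP := hη.measure_le S A (ε := ε) fun n => by
        refine (measure_mono fun ω hω => ?_).trans (hK n)
        have h1 : ChangesOn (fun t => finState lam ω t x) (Dm m : Set ℝ≥0) (K + 1) := by
          rw [← hconv]
          simpa [A] using hω
        exact (changesOn_of_finState h1).le_changes
      refine (measure_mono fun ω hω => ?_).trans hP
      have h1 := (hconv fun t => η t ω x).2 hω
      simpa [A] using h1
    · intro i j hij ω hω
      rw [Set.mem_ofPred_eq] at hω ⊢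
      exact hω.mono (Finset.coe_subset.2 (hDm hij))
  have hae : ∀ x : ℤ, ∀ᵐ ω ∂P, ∃ K, ¬ ChangesOn (fun t => η t ω x) D K := by
    intro x
    refine (ae_iff).2 (le_antisymm (ENNReal.le_of_forall_pos_le_add fun ε hε _ => ?_) zero_le)
    obtain ⟨K, hK⟩ := hbound x ε (by exact_mod_cast hε)
    rw [zero_add]
    exact (measure_mono fun ω hω => by simpa using not_exists.1 hω K).trans hK
  filter_upwards [ae_all_iff.2 hae, hη.right_continuous] with ω h1 h2 x
  obtain ⟨K, hK⟩ := h1 x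
  exact eventually_const_of_not_changesOn (h2 x) hD hK

/-! ### Exploration of a half-line. -/

/-- The instruction `i` occurs infinitely often. -/
def Recurrent (i : Instruction) (w : ℕ → Instruction) : Prop := ∀ m, ∃ k, m ≤ occ i w k

/-- The number of instructions performed until `i` has occurred `l` times. -/
def hit (i : Instruction) (w : ℕ → Instruction) (l : ℕ) : ℕ := sInf {k | l ≤ occ i w k}

theorem occ_le (i : Instruction) (w : ℕ → Instruction) (k : ℕ) : occ i w k ≤ k :=
  Nat.count_le _

theorem occ_hit {i : Instruction} {w : ℕ → Instruction} (hw : Recurrent i w) (l : ℕ) :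
    occ i w (hit i w l) = l := by
  have h1 : l ≤ occ i w (hit i w l) := Nat.sInf_mem (hw l)
  refine le_antisymm ?_ h1
  rcases hk : hit i w l with _ | k
  · simp
  · have h2 : k ∉ {k | l ≤ occ i w k} := Nat.notMem_of_lt_sInf (by
      change k < hit i w l
      omega)
    rw [Set.mem_ofPred_eq, not_le] at h2
    rw [occ_succ]
    split_ifs <;> omega

theorem tendsto_hit {i : Instruction} {w : ℕ → Instruction} (hw : Recurrent i w) :
    Tendsto (hit i w) atTop atTop :=
  tendsto_atTop_mono (fun l => (occ_hit hw l).ge.trans (occ_le i w _)) tendsto_id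

theorem Recurrent.tendsto_occ {i : Instruction} {w : ℕ → Instruction} (hw : Recurrent i w) :
    Tendsto (occ i w) atTop atTop :=
  tendsto_atTop_atTop_of_monotone (occ_mono i w) hw

/-- The number of instructions performed at a site that has to send `l` particles towards the
origin: up to the `l`-th such jump, and the next instruction if it is a sleep attempt. -/
def siteOdo (tw : Instruction) (w : ℕ → Instruction) (l : ℕ) : ℕ :=
  hit tw w l + if w (hit tw w l) = none then 1 else 0

/-- One step of the exploration of a half-line: `q.1` is the net flow of particles towards the
origin across the last edge, and `q.2` is the number of jumps away from the origin across it. -/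
def sideStep (tw aw : Instruction) (q : ℤ × ℕ) (m : ℕ) (w : ℕ → Instruction) : ℤ × ℕ :=
  (q.1 + (if w (hit tw w (q.1 + q.2).toNat) = none then 1 else 0) - m,
    occ aw w (hit tw w (q.1 + q.2).toNat))

/-- The exploration of a half-line from the initial flows `q`. -/
def side (tw aw : Instruction) (ζ : ℕ → ℕ) (F : ℕ → ℕ → Instruction) (q : ℤ × ℕ) : ℕ → ℤ × ℕ
  | 0 => q
  | j + 1 => sideStep tw aw (side tw aw ζ F q j) (ζ (j + 1)) (F (j + 1))

/-- The additional instruction is a sleep attempt, so it adds no jump. -/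
theorem occ_siteOdo {i tw : Instruction} (hi : i ≠ none) (w : ℕ → Instruction) (l : ℕ) :
    occ i w (siteOdo tw w l) = occ i w (hit tw w l) := by
  unfold siteOdo
  split_ifs with h
  · rw [occ_succ, h, if_neg (Ne.symm hi), add_zero]
  · rfl

theorem inflow_eq (F : Field) (h : ℤ → ℕ) {d : ℤ} (hd : d = 1 ∨ d = -1) (y : ℤ) :
    inflow F h y = occ (some d) (F (y - d)) (h (y - d)) +
      occ (some (-d)) (F (y + d)) (h (y + d)) := by
  rcases hd with rfl | rfl
  · rfl
  · simp [inflow, add_comm, sub_eq_add_neg]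

theorem outflow_eq (F : Field) (h : ℤ → ℕ) {d : ℤ} (hd : d = 1 ∨ d = -1) (y : ℤ) :
    outflow F h y = occ (some d) (F y) (h y) + occ (some (-d)) (F y) (h y) := by
  rcases hd with rfl | rfl
  · rfl
  · simp [outflow, add_comm]

/-- The exploration of the half-line from `x` in direction `d`. -/
def rayState (d x : ℤ) (ζ : ℤ → ℕ) (F : Field) (q : ℤ × ℕ) : ℕ → ℤ × ℕ :=
  side (some (-d)) (some d) (fun j => ζ (x + d * j)) (fun j => F (x + d * j)) q

/-- The number of instructions to perform at the `j + 1`-st site of the half-line. -/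
def rayOdo (d x : ℤ) (ζ : ℤ → ℕ) (F : Field) (q : ℤ × ℕ) (j : ℕ) : ℕ :=
  siteOdo (some (-d)) (F (x + d * (j + 1)))
    ((rayState d x ζ F q j).1 + (rayState d x ζ F q j).2).toNat

/-- Nonnegativity makes `toNat` exact: a negative number of jumps could not be realised. -/
theorem occ_rayOdo_toward {d x : ℤ} {ζ : ℤ → ℕ} {F : Field} {q : ℤ × ℕ} {j : ℕ}
    (hrec : ∀ y, Recurrent (some (-d)) (F y))
    (hgood : ∀ j, 0 ≤ (rayState d x ζ F q j).1 + (rayState d x ζ F q j).2) :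
    (occ (some (-d)) (F (x + d * (j + 1))) (rayOdo d x ζ F q j) : ℤ) =
      (rayState d x ζ F q j).1 + (rayState d x ζ F q j).2 := by
  rw [rayOdo, occ_siteOdo (by simp), occ_hit (hrec _), Int.toNat_of_nonneg (hgood j)]

theorem occ_rayOdo_away {d x : ℤ} {ζ : ℤ → ℕ} {F : Field} {q : ℤ × ℕ} {j : ℕ} :
    occ (some d) (F (x + d * (j + 1))) (rayOdo d x ζ F q j) =
      (rayState d x ζ F q (j + 1)).2 := by
  rw [rayOdo, occ_siteOdo (by simp)]
  simp [rayState, side, sideStep]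

/-- As long as the flows are nonnegative, the explored half-line is stable. -/
theorem stableAt_ray {d x : ℤ} (hd : d = 1 ∨ d = -1) {ζ : ℤ → ℕ} {F : Field} {f : ℤ}
    {h : ℤ → ℕ} {η : FinConfig} (hη : ∀ y, (η y).particles ≤ ζ y)
    (hrec : ∀ y, Recurrent (some (-d)) (F y))
    (hgood : ∀ j, 0 ≤ (rayState d x ζ F (f, occ (some d) (F x) (h x)) j).1 +
      (rayState d x ζ F (f, occ (some d) (F x) (h x)) j).2)
    (hh : ∀ j : ℕ, h (x + d * (j + 1)) = rayOdo d x ζ F (f, occ (some d) (F x) (h x)) j) (j : ℕ) :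
    StableAt F η h (x + d * (j + 1)) := by
  set q : ℤ × ℕ := (f, occ (some d) (F x) (h x))
  have hprev : occ (some d) (F (x + d * (j + 1) - d)) (h (x + d * (j + 1) - d)) =
      (rayState d x ζ F q j).2 := by
    cases j with
    | zero =>
      have : x + d * ((0 : ℕ) + 1) - d = x := by push_cast; ring
      rw [this]
      rfl
    | succ j =>
      have : x + d * ((j + 1 : ℕ) + 1) - d = x + d * (j + 1) := by push_cast; ring
      rw [this, hh j, occ_rayOdo_away]
  have hnext : (occ (some (-d)) (F (x + d * (j + 1) + d)) (h (x + d * (j + 1) + d)) : ℤ) =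
      (rayState d x ζ F q (j + 1)).1 + (rayState d x ζ F q (j + 1)).2 := by
    have : x + d * ((j : ℤ) + 1) + d = x + d * ((j + 1 : ℕ) + 1) := by push_cast; ring
    rw [this, hh (j + 1), occ_rayOdo_toward hrec hgood]
  have htow := occ_rayOdo_toward (j := j) hrec hgood
  have haw := occ_rayOdo_away (d := d) (x := x) (ζ := ζ) (F := F) (q := q) (j := j)
  rw [← hh j] at htow haw
  -- An inequality suffices here, which is why one `h` serves all truncations.
  have hpart := hη (x + d * (j + 1))
  -- With `f` and `a` the two components, the inflow is `a_j + f_{j+1} + a_{j+1}` and the outflow is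
  -- `f_j + a_j + a_{j+1}`. The jumps away cancel, and the recursion is the balance of particles at
  -- this site.
  have hf : (rayState d x ζ F q (j + 1)).1 = (rayState d x ζ F q j).1 +
      (if F (x + d * (j + 1)) (hit (some (-d)) (F (x + d * (j + 1)))
        ((rayState d x ζ F q j).1 + (rayState d x ζ F q j).2).toNat) = none then 1 else 0) -
      ζ (x + d * (j + 1)) := by
    simp [rayState, side, sideStep]
    congr
  have hodo := hh j
  simp only [rayOdo, siteOdo] at hodo
  have hin := inflow_eq F h hd (x + d * (j + 1))
  have hout := outflow_eq F h hd (x + d * (j + 1))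
  split_ifs at hf hodo with hs
  · right; left
    refine ⟨by omega, by omega, ?_⟩
    rw [hodo]
    simpa using hs
  · left
    omega

theorem measurable_occ (i : Instruction) (k : ℕ) : Measurable fun w => occ i w k := by
  induction k with
  | zero => simp
  | succ k ih =>
    simp only [occ_succ]
    refine ih.add ?_
    exact (Measurable.of_discrete (f := fun a : Instruction => if a = i then 1 else 0)).comp
      (measurable_pi_apply k)

theorem measurable_hit (i : Instruction) (l : ℕ) : Measurable fun w => hit i w l :=
  measurable_sInf_nat fun k => (measurable_occ i k) measurableSet_Ici

theorem measurable_eval_hit (i : Instruction) (l : ℕ) :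
    Measurable fun w : ℕ → Instruction => w (hit i w l) := by
  have hev : Measurable fun q : (ℕ → Instruction) × ℕ => q.1 q.2 :=
    measurable_from_prod_countable_left fun k => measurable_pi_apply k
  exact hev.comp (measurable_id.prodMk (measurable_hit i l))

theorem measurable_sideStep (tw aw : Instruction) :
    Measurable fun a : ((ℤ × ℕ) × ℕ) × (ℕ → Instruction) => sideStep tw aw a.1.1 a.1.2 a.2 := by
  refine measurable_from_prod_countable_right fun a => ?_
  refine Measurable.prodMk ?_ ?_
  · exact (Measurable.of_discrete (f := fun b : Instruction =>
      a.1.1 + (if b = none then 1 else 0) - (a.2 : ℤ))).comp 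
      (measurable_eval_hit tw (a.1.1 + a.1.2).toNat)
  · have hev : Measurable fun b : (ℕ → Instruction) × ℕ => occ aw b.1 b.2 :=
      measurable_from_prod_countable_left fun k => measurable_occ aw k
    exact hev.comp (measurable_id.prodMk (measurable_hit tw (a.1.1 + a.1.2).toNat))

theorem measurable_side (tw aw : Instruction) (j : ℕ) :
    Measurable fun a : ((ℕ → ℕ) × (ℕ → ℕ → Instruction)) × (ℤ × ℕ) =>
      side tw aw a.1.1 a.1.2 a.2 j := by
  induction j with
  | zero => exact measurable_snd
  | succ j ih =>
    refine (measurable_sideStep tw aw).comp (Measurable.prodMk (ih.prodMk ?_) ?_)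
    · fun_prop
    · fun_prop

/-- If the initial flows tend to infinity, then so do all flows. -/
theorem tendsto_side {tw aw : Instruction} {ζ : ℕ → ℕ} {F : ℕ → ℕ → Instruction}
    (htw : ∀ j, Recurrent tw (F j)) {q : ℕ → ℤ × ℕ} (hq : ∃ b : ℤ, ∀ H, b ≤ (q H).1)
    (h : (∀ j, Recurrent aw (F j)) ∧ Tendsto (fun H => (q H).1 + (q H).2) atTop atTop ∨
      Tendsto (fun H => (q H).1) atTop atTop) (j : ℕ) :
    Tendsto (fun H => (side tw aw ζ F (q H) j).1 + (side tw aw ζ F (q H) j).2) atTop atTop := by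
  have hstep : ∀ (a : ℤ × ℕ) (m : ℕ) (w : ℕ → Instruction),
      a.1 - m ≤ (sideStep tw aw a m w).1 := by
    intro a m w
    simp only [sideStep]
    split_ifs <;> omega
  -- If jumps away recur, reading more of a stack produces more of them, while the flow stays
  -- bounded below in `H`. Otherwise the flow itself diverges, since each site lowers it by at most
  -- its initial number of particles.
  rcases h with ⟨haw, h⟩ | h
  · suffices (∃ b : ℤ, ∀ H, b ≤ (side tw aw ζ F (q H) j).1) ∧
        Tendsto (fun H => (side tw aw ζ F (q H) j).1 + (side tw aw ζ F (q H) j).2) atTop atTop from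
      this.2
    induction j with
    | zero => exact ⟨hq, h⟩
    | succ j ih =>
      obtain ⟨⟨b, hb⟩, ih⟩ := ih
      have hb' : ∀ H, b - ζ (j + 1) ≤ (side tw aw ζ F (q H) (j + 1)).1 := fun H =>
        (sub_le_sub_right (hb H) _).trans (hstep _ _ _)
      refine ⟨⟨_, hb'⟩, ?_⟩
      have h1 : Tendsto (fun H => ((side tw aw ζ F (q H) j).1 +
          (side tw aw ζ F (q H) j).2).toNat) atTop atTop := by
        refine tendsto_atTop.2 fun m => ?_
        filter_upwards [tendsto_atTop.1 ih (m : ℤ)] with H hH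
        omega
      have h2 := (haw (j + 1)).tendsto_occ.comp ((tendsto_hit (htw (j + 1))).comp h1)
      have h3 : Tendsto (fun H => ((side tw aw ζ F (q H) (j + 1)).2 : ℤ)) atTop atTop :=
        tendsto_natCast_atTop_atTop.comp h2
      exact tendsto_atTop_add_left_of_le _ _ hb' h3
  · have h1 : ∀ j, Tendsto (fun H => (side tw aw ζ F (q H) j).1) atTop atTop := by
      intro j
      induction j with
      | zero => exact h
      | succ j ih =>
        refine tendsto_atTop_mono (fun H => hstep _ _ _) ?_
        exact tendsto_atTop_add_const_right _ (-(ζ (j + 1) : ℤ)) ih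
    exact tendsto_atTop_mono (fun H => by simp) (h1 j)

/-- The exploration does not depend on the sites that have not been visited. -/
theorem side_congr {tw aw : Instruction} {ζ : ℕ → ℕ} {F G : ℕ → ℕ → Instruction} (q : ℤ × ℕ)
    {j : ℕ} (h : ∀ i ≤ j, F i = G i) : side tw aw ζ F q j = side tw aw ζ G q j := by
  induction j with
  | zero => rfl
  | succ j ih =>
    rw [side, side, ih fun i hi => h i (by omega), h (j + 1) le_rfl]

/-! ### Exponential moments of the flow. -/

/-- Integrate one coordinate first. -/
theorem lintegral_update {ι : Type*} [DecidableEq ι] {X : Type*} [MeasurableSpace X]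
    (ν : Measure X) [IsProbabilityMeasure ν] (k : ι) {f : (ι → X) → ℝ≥0∞} (hf : Measurable f) :
    ∫⁻ F, f F ∂(Measure.infinitePi fun _ : ι => ν) =
      ∫⁻ F, ∫⁻ w, f (Function.update F k w) ∂ν ∂(Measure.infinitePi fun _ : ι => ν) := by
  have hU := measurePreserving_update ν k
  rw [← hU.lintegral_comp hf]
  exact lintegral_prod _ (hf.comp hU.measurable).aemeasurable

theorem ae_recurrent {r : PMF Instruction} {i : Instruction} (hi : r i ≠ 0) :
    ∀ᵐ w ∂stackLaw r, Recurrent i w := by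
  have hN : ∀ N, ∀ᵐ w ∂stackLaw r, ∃ n, N ≤ n ∧ w n = i := by
    intro N
    rw [ae_iff]
    have hlt : r.toMeasure {i}ᶜ < 1 := by
      rw [prob_compl_eq_one_sub (MeasurableSet.singleton _),
        PMF.toMeasure_apply_singleton _ _ (MeasurableSet.singleton _)]
      exact ENNReal.sub_lt_self ENNReal.one_ne_top one_ne_zero hi
    refine le_antisymm (ge_of_tendsto' (ENNReal.tendsto_pow_atTop_nhds_zero_of_lt_one hlt)
      fun m => ?_) zero_le
    have hsub : {w : ℕ → Instruction | ¬ ∃ n, N ≤ n ∧ w n = i} ⊆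
        ((Finset.Ico N (N + m) : Finset ℕ) : Set ℕ).pi fun _ => {i}ᶜ := by
      intro w hw n hn hc
      exact hw ⟨n, (Finset.mem_Ico.1 (Finset.mem_coe.1 hn)).1, hc⟩
    refine (measure_mono hsub).trans ?_
    rw [stackLaw, Measure.infinitePi_pi _ fun _ _ => (MeasurableSet.singleton i).compl]
    simp
  filter_upwards [ae_all_iff.2 hN] with w hw m
  induction m with
  | zero => exact ⟨0, zero_le⟩
  | succ m ih =>
    obtain ⟨k, hk⟩ := ih
    obtain ⟨n, hn, hwn⟩ := hw k
    refine ⟨n + 1, ?_⟩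
    rw [occ_succ, if_pos hwn]
    have := occ_mono i w hn
    omega

theorem occ_congr {i : Instruction} {w v : ℕ → Instruction} {k : ℕ} (h : ∀ n < k, w n = v n) :
    occ i w k = occ i v k := by
  induction k with
  | zero => simp
  | succ k ih => rw [occ_succ, occ_succ, ih fun n hn => h n (by omega), h k (by omega)]

/-- The instruction that follows the `l`-th occurrence of `i` has the law of an instruction. -/
theorem lintegral_eval_hit {r : PMF Instruction} {i : Instruction} (hi : r i ≠ 0) (l : ℕ)
    (φ : Instruction → ℝ≥0∞) :
    ∫⁻ w, φ (w (hit i w l)) ∂stackLaw r = ∫⁻ a, φ a ∂r.toMeasure := by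
  -- `A k` is almost surely the event that the hitting index is `k`. It involves only the
  -- instructions before index `k`, so the one at `k` can be resampled.
  let A : ℕ → Set (ℕ → Instruction) := fun k => {w | l ≤ occ i w k ∧ ∀ m < k, occ i w m < l}
  have hAm : ∀ k, MeasurableSet (A k) := fun k => by
    have : A k = {w | l ≤ occ i w k} ∩ ⋂ m ∈ Set.Iio k, {w | occ i w m < l} := by
      ext w; simp [A]
    rw [this]
    exact ((measurable_occ i k) measurableSet_Ici).inter (MeasurableSet.biInter
      (Set.to_countable _) fun m _ => (measurable_occ i m) measurableSet_Iio)
  have hA : ∀ w, Recurrent i w → ∀ k, w ∈ A k ↔ k = hit i w l := by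
    intro w hw k
    constructor
    · rintro ⟨h1, h2⟩
      refine le_antisymm (not_lt.1 fun h => ?_) (Nat.sInf_le h1)
      have h3 := h2 _ h
      rw [occ_hit hw] at h3
      omega
    · rintro rfl
      exact ⟨(occ_hit hw l).ge, fun m hm => not_le.1 (Nat.notMem_of_lt_sInf hm :
        m ∉ {k | l ≤ occ i w k})⟩
  have hφ : ∀ k, Measurable fun w : ℕ → Instruction => φ (w k) := fun k =>
    (Measurable.of_discrete (f := φ)).comp (measurable_pi_apply k)
  have hsum : ∀ (g : ℕ → (ℕ → Instruction) → ℝ≥0∞) (w : ℕ → Instruction), Recurrent i w →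
      ∑' k, (A k).indicator (g k) w = g (hit i w l) w := by
    intro g w hw
    rw [tsum_eq_single (hit i w l) fun k hk => Set.indicator_of_notMem (by rwa [hA w hw]) _]
    exact Set.indicator_of_mem ((hA w hw _).2 rfl) _
  have hupd : ∀ k, ∫⁻ w, (A k).indicator (fun w => φ (w k)) w ∂stackLaw r =
      (∫⁻ w, (A k).indicator 1 w ∂stackLaw r) * ∫⁻ a, φ a ∂r.toMeasure := by
    intro k
    rw [← lintegral_mul_const _ (measurable_one.indicator (hAm k))]
    refine (lintegral_update r.toMeasure k ((hφ k).indicator (hAm k))).trans ?_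
    refine lintegral_congr fun w => ?_
    rw [← lintegral_const_mul _ Measurable.of_discrete]
    refine lintegral_congr fun a => ?_
    have hmem : Function.update w k a ∈ A k ↔ w ∈ A k := by
      have hocc : ∀ m ≤ k, occ i (Function.update w k a) m = occ i w m := fun m hm =>
        occ_congr fun n hn => Function.update_of_ne (by omega) _ _
      simp only [A, Set.mem_ofPred_eq, hocc k le_rfl]
      exact and_congr_right fun _ => forall₂_congr fun m hm => by rw [hocc m hm.le]
    by_cases hw : w ∈ A k
    · simp [hw, hmem]
    · simp [hw, hmem]
  calc _ = ∫⁻ w, ∑' k, (A k).indicator (fun w => φ (w k)) w ∂stackLaw r := by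
        refine lintegral_congr_ae ?_
        filter_upwards [ae_recurrent hi] with w hw
        exact (hsum (fun k w => φ (w k)) w hw).symm
    _ = ∑' k, (∫⁻ w, (A k).indicator 1 w ∂stackLaw r) * ∫⁻ a, φ a ∂r.toMeasure := by
        rw [lintegral_tsum fun k => ((hφ k).indicator (hAm k)).aemeasurable]
        exact tsum_congr hupd
    _ = (∫⁻ w, ∑' k, (A k).indicator 1 w ∂stackLaw r) * ∫⁻ a, φ a ∂r.toMeasure := by
        rw [ENNReal.tsum_mul_right,
          lintegral_tsum fun k => (measurable_one.indicator (hAm k)).aemeasurable]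
    _ = _ := by
        have : ∫⁻ w, ∑' k, (A k).indicator 1 w ∂stackLaw r = ∫⁻ _, 1 ∂stackLaw r := by
          refine lintegral_congr_ae ?_
          filter_upwards [ae_recurrent hi] with w hw
          exact hsum (fun _ => 1) w hw
        rw [this, lintegral_one, measure_univ, one_mul]

/-- The mean of `T ^ (-1)` for a sleep attempt and of `1` for a jump. -/
def sleepWeight (r : PMF Instruction) (T : ℝ≥0∞) : ℝ≥0∞ :=
  ∫⁻ a, (if a = none then T⁻¹ else 1) ∂r.toMeasure

/-- Exponential bound for the flow, for a fixed initial configuration. -/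
theorem lintegral_side_le {r : PMF Instruction} {tw : Instruction} (htw : r tw ≠ 0)
    (aw : Instruction) {T : ℝ≥0∞} (hT : 1 ≤ T) (hT' : T ≠ ∞) {e : ℕ → ℤ} (he : e.Injective)
    (ζ : ℕ → ℕ) (q : (ℕ → Instruction) → ℤ × ℕ) (hqm : Measurable q)
    (hq : ∀ w, -(ζ 0 : ℤ) ≤ (q w).1) (j : ℕ) :
    ∫⁻ F, T ^ (-(side tw aw ζ (fun i => F (e i)) (q (F (e 0))) j).1) ∂fieldLaw r ≤
      T ^ (∑ i ∈ Finset.range (j + 1), ζ i) * sleepWeight r T ^ j := by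
  have hT0 : T ≠ 0 := (zero_lt_one.trans_le hT).ne'
  have hmeas : ∀ j, Measurable fun F : Field => side tw aw ζ (fun i => F (e i)) (q (F (e 0))) j := by
    intro j
    exact (measurable_side tw aw j).comp ((measurable_const.prodMk (by fun_prop)).prodMk
      (hqm.comp (measurable_pi_apply (e 0))) : Measurable fun F : Field =>
        ((ζ, fun i => F (e i)), q (F (e 0))))
  have hW : Measurable fun a : ℤ × ℕ => T ^ (-a.1) := Measurable.of_discrete
  induction j with
  | zero =>
    calc _ ≤ ∫⁻ _F, T ^ (ζ 0) ∂fieldLaw r := by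
          refine lintegral_mono fun F => ?_
          rw [← zpow_natCast]
          exact ENNReal.zpow_le_of_le hT (by simpa [side] using neg_le.1 (hq (F (e 0))))
      _ = _ := by simp
  | succ j ih =>
    -- Only the last step sees the stack at `e (j + 1)`. Its hitting level is fixed by the previous
    -- stacks, so the increment of the flow has an explicit mean weight.
    have hin : ∀ F : Field, ∫⁻ w, T ^ (-(side tw aw ζ
          (fun i => Function.update F (e (j + 1)) w (e i))
          (q (Function.update F (e (j + 1)) w (e 0))) (j + 1)).1) ∂stackLaw r =
        T ^ (-(side tw aw ζ (fun i => F (e i)) (q (F (e 0))) j).1) *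
          (T ^ ζ (j + 1) * sleepWeight r T) := by
      intro F
      rw [sleepWeight, ← lintegral_eval_hit htw (((side tw aw ζ (fun i => F (e i))
        (q (F (e 0))) j).1 + (side tw aw ζ (fun i => F (e i)) (q (F (e 0))) j).2).toNat),
        ← mul_assoc, ← lintegral_const_mul]
      · refine lintegral_congr fun w => ?_
        have hne : ∀ i ≤ j, Function.update F (e (j + 1)) w (e i) = F (e i) := fun i hi =>
          Function.update_of_ne (he.ne (by omega)) _ _
        rw [side, hne 0 zero_le, side_congr (G := fun i => F (e i)) _ hne]
        simp only [sideStep, Function.update_self]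
        rw [← zpow_natCast, ← ENNReal.zpow_add hT0 hT']
        split_ifs
        · rw [← zpow_neg_one, ← ENNReal.zpow_add hT0 hT']
          congr 1
          ring
        · rw [mul_one]
          congr 1
          ring
      · exact (Measurable.of_discrete (f := fun a : Instruction =>
          if a = none then T⁻¹ else 1)).comp (measurable_eval_hit tw _)
    refine (lintegral_update (stackLaw r) (e (j + 1)) (hW.comp (hmeas (j + 1)))).trans_le ?_
    simp only [Function.comp_apply, hin]
    have hWj : Measurable fun F : Field =>
        T ^ (-(side tw aw ζ (fun i => F (e i)) (q (F (e 0))) j).1) := hW.comp (hmeas j)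
    rw [← fieldLaw, lintegral_mul_const _ hWj]
    refine (mul_le_mul_left ih _).trans (le_of_eq ?_)
    rw [Finset.sum_range_succ _ (j + 1), pow_add, pow_succ]
    ring

theorem lintegral_poisson_pow (μ : ℝ≥0) (T : ℝ≥0) :
    ∫⁻ n, (T : ℝ≥0∞) ^ n ∂poissonMeasure μ = ENNReal.ofReal (Real.exp (μ * (T - 1))) := by
  rw [lintegral_countable']
  simp only [poissonMeasure_singleton]
  have h1 : HasSum (fun n : ℕ => Real.exp (-μ) * ((μ * T : ℝ) ^ n / n.factorial))
      (Real.exp (-μ) * Real.exp (μ * T)) := by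
    rw [Real.exp_eq_exp_ℝ]
    exact (NormedSpace.expSeries_div_hasSum_exp ((μ : ℝ) * T)).mul_left _
  rw [← Real.exp_add] at h1
  rw [show (μ : ℝ) * (T - 1) = -μ + μ * T by ring, ← h1.tsum_eq,
    ENNReal.ofReal_tsum_of_nonneg (fun n => by positivity) h1.summable]
  refine tsum_congr fun n => ?_
  rw [← ENNReal.ofReal_coe_nnreal, ← ENNReal.ofReal_pow (by positivity),
    ← ENNReal.ofReal_mul (by positivity)]
  congr 1
  rw [mul_pow]
  ring

theorem lintegral_pow_sum (ν : Measure ℕ) [IsProbabilityMeasure ν] (T : ℝ≥0∞) {e : ℕ → ℤ}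
    (he : e.Injective) (j : ℕ) :
    ∫⁻ ζ, T ^ (∑ i ∈ Finset.range j, ζ (e i)) ∂(Measure.infinitePi fun _ : ℤ => ν) =
      (∫⁻ n, T ^ n ∂ν) ^ j := by
  have hm : ∀ j, Measurable fun ζ : ℤ → ℕ => T ^ (∑ i ∈ Finset.range j, ζ (e i)) := fun j =>
    (Measurable.of_discrete (f := fun n : ℕ => T ^ n)).comp (by fun_prop)
  induction j with
  | zero => simp
  | succ j ih =>
    rw [lintegral_update ν (e j) (hm (j + 1)), pow_succ, ← ih, ← lintegral_mul_const _ (hm j)]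
    refine lintegral_congr fun ζ => ?_
    rw [← lintegral_const_mul _ Measurable.of_discrete]
    refine lintegral_congr fun n => ?_
    rw [Finset.sum_range_succ, pow_add, Function.update_self]
    congr 2
    refine Finset.sum_congr rfl fun i hi => ?_
    exact Function.update_of_ne (he.ne (Finset.mem_range.1 hi).ne) _ _

theorem instructionLaw_none (lam : ℝ≥0) (p : PMF ℤ) :
    instructionLaw lam p none = ((lam / (1 + lam) : ℝ≥0) : ℝ≥0∞) := rfl

theorem instructionLaw_some (lam : ℝ≥0) (p : PMF ℤ) (z : ℤ) :
    instructionLaw lam p (some z) = p z * ((1 / (1 + lam) : ℝ≥0) : ℝ≥0∞) := rfl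

theorem sleepWeight_eq (r : PMF Instruction) (T : ℝ≥0∞) :
    sleepWeight r T = T⁻¹ * r none + (1 - r none) := by
  have h1 : ∀ a : Instruction, (if a = none then T⁻¹ else 1) =
      ({none} : Set Instruction).indicator (fun _ => T⁻¹) a +
        ({none}ᶜ : Set Instruction).indicator (fun _ => 1) a := by
    intro a
    by_cases h : a = none <;> simp [h]
  simp only [sleepWeight, h1]
  rw [lintegral_add_left Measurable.of_discrete,
    lintegral_indicator_const (MeasurableSet.singleton _),
    lintegral_indicator_const (MeasurableSet.singleton _).compl,
    prob_compl_eq_one_sub (MeasurableSet.singleton _),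
    PMF.toMeasure_apply_singleton _ _ (MeasurableSet.singleton _), one_mul]

/-- Below the density `λ / (1 + λ)` the exponential moments of the flow decay. -/
theorem exists_decay {lam μ : ℝ≥0} (h : μ < lam / (1 + lam)) (p : PMF ℤ) :
    ∃ T : ℝ≥0, 1 ≤ T ∧
      (∫⁻ n, (T : ℝ≥0∞) ^ n ∂poissonMeasure μ) * sleepWeight (instructionLaw lam p) T < 1 := by
  set s : ℝ≥0 := lam / (1 + lam)
  have hs1 : s ≤ 1 := div_le_one_of_le₀ (by simp) zero_le
  -- The product is at most `exp ((T - 1) * (μ - s / T))`, which is below `1` as soon as `T > 1` and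
  -- `μ * T < s`.
  obtain ⟨T, hT1, hT2⟩ : ∃ T : ℝ≥0, 1 < T ∧ μ * T < s := by
    rcases eq_or_ne μ 0 with rfl | hμ
    · exact ⟨2, one_lt_two, by simpa using h⟩
    · have hμ' : 0 < μ := pos_iff_ne_zero.2 hμ
      obtain ⟨m, hm1, hm2⟩ := exists_between h
      exact ⟨m / μ, (one_lt_div hμ').2 hm1, by rwa [mul_div_cancel₀ _ hμ]⟩
  refine ⟨T, hT1.le, ?_⟩
  have hT0 : T ≠ 0 := (zero_lt_one.trans hT1).ne'
  have hw : sleepWeight (instructionLaw lam p) T = ENNReal.ofReal (1 - s * (1 - (T : ℝ)⁻¹)) := by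
    rw [sleepWeight_eq, instructionLaw_none, ← ENNReal.coe_inv hT0, ← ENNReal.coe_one,
      ← ENNReal.coe_sub, ← ENNReal.coe_mul, ← ENNReal.coe_add, ← ENNReal.ofReal_coe_nnreal]
    congr 1
    rw [NNReal.coe_add, NNReal.coe_mul, NNReal.coe_inv, NNReal.coe_sub hs1, NNReal.coe_one]
    ring
  have hT1' : (1 : ℝ) < T := by exact_mod_cast hT1
  have hT2' : (μ : ℝ) * T < s := by exact_mod_cast hT2
  rw [lintegral_poisson_pow, hw, ← ENNReal.ofReal_mul (Real.exp_pos _).le,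
    ENNReal.ofReal_lt_one]
  calc _ ≤ Real.exp (μ * (T - 1)) * Real.exp (-(s * (1 - (T : ℝ)⁻¹))) := by
        gcongr
        have := Real.add_one_le_exp (-(s * (1 - (T : ℝ)⁻¹)))
        linarith
    _ < 1 := by
        rw [← Real.exp_add, Real.exp_lt_one_iff]
        have h1 : (1 : ℝ) - (T : ℝ)⁻¹ = (T - 1) * (T : ℝ)⁻¹ := by
          field_simp
        have h2 : (μ : ℝ) < s * (T : ℝ)⁻¹ := by
          rw [← div_eq_mul_inv, lt_div_iff₀ (by linarith)]
          exact hT2'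
        rw [h1]
        nlinarith [mul_pos (sub_pos.2 h2) (sub_pos.2 hT1')]

/-! ### The exploration rarely fails. -/

/-- The joint law of the initial numbers of particles and of the instructions. -/
def envLaw (μ : ℝ≥0) (r : PMF Instruction) : Measure ((ℤ → ℕ) × Field) :=
  (Measure.infinitePi fun _ : ℤ => poissonMeasure μ).prod (fieldLaw r)

instance (μ : ℝ≥0) (r : PMF Instruction) : IsProbabilityMeasure (envLaw μ r) := by
  unfold envLaw; infer_instance

theorem ae_envLaw_of_stackLaw {μ : ℝ≥0} {r : PMF Instruction} {Q : (ℕ → Instruction) → Prop}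
    (h : ∀ᵐ w ∂stackLaw r, Q w) : ∀ᵐ a ∂envLaw μ r, ∀ y, Q (a.2 y) := by
  refine ae_all_iff.2 fun y => ?_
  have h1 : ∀ᵐ F ∂fieldLaw r, Q (F y) :=
    (measurePreserving_eval_infinitePi (fun _ : ℤ => stackLaw r) y).quasiMeasurePreserving.ae h
  exact Measure.quasiMeasurePreserving_snd.ae h1

theorem ae_stackLaw_support (r : PMF Instruction) : ∀ᵐ w ∂stackLaw r, ∀ n, r (w n) ≠ 0 := by
  refine ae_all_iff.2 fun n => ?_
  refine (measurePreserving_eval_infinitePi (fun _ : ℕ => r.toMeasure) n).quasiMeasurePreserving.ae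
    (p := fun a => r a ≠ 0) ?_
  rw [ae_iff, PMF.toMeasure_apply_eq_zero_iff _ MeasurableSet.of_discrete]
  refine Set.disjoint_left.2 fun a ha hb => ?_
  exact hb ((PMF.mem_support_iff r a).1 ha)

/-- The initial flows at `x` when `H` instructions are performed there. -/
def rayStart (d x : ℤ) (f : ℕ → ℕ → (ℕ → Instruction) → ℤ) (H : ℕ) (a : (ℤ → ℕ) × Field) : ℤ × ℕ :=
  (f H (a.1 x) (a.2 x), occ (some d) (a.2 x) H)

/-- The flow becomes negative along the half-line from `x` in direction `d`. -/
def rayBad (d x : ℤ) (f : ℕ → ℕ → (ℕ → Instruction) → ℤ) (H : ℕ) : Set ((ℤ → ℕ) × Field) :=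
  {a | ∃ j, (rayState d x a.1 a.2 (rayStart d x f H a) j).1 +
    (rayState d x a.1 a.2 (rayStart d x f H a) j).2 < 0}

/-- A failure at distance `j` forces the flow itself to be negative. Its probability decays
geometrically in `j`, uniformly in `H`, because only the lower bound `-ζ x` on the initial flow
enters. The finitely many remaining distances are treated by letting `H` tend to infinity. -/
theorem tendsto_rayBad {lam μ : ℝ≥0} (hμ : μ < lam / (1 + lam)) (p : PMF ℤ) {d : ℤ} (hd : d ≠ 0)
    (x : ℤ) (htw : instructionLaw lam p (some (-d)) ≠ 0) (f : ℕ → ℕ → (ℕ → Instruction) → ℤ)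
    (hfm : ∀ H, Measurable fun a : ℕ × (ℕ → Instruction) => f H a.1 a.2)
    (hf : ∀ (H m : ℕ) (w : ℕ → Instruction), -(m : ℤ) ≤ f H m w)
    (h : instructionLaw lam p (some d) ≠ 0 ∨
      ∀ m w, Recurrent (some (-d)) w → Tendsto (fun H => f H m w) atTop atTop) :
    Tendsto (fun H => envLaw μ (instructionLaw lam p) (rayBad d x f H)) atTop (𝓝 0) := by
  set r := instructionLaw lam p
  obtain ⟨T, hT1, hT2⟩ := exists_decay hμ p
  set M := ∫⁻ n, (T : ℝ≥0∞) ^ n ∂poissonMeasure μ with hM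
  have hMfin : M ≠ ∞ := by
    rw [hM, lintegral_poisson_pow]
    exact ENNReal.ofReal_ne_top
  let st : ℕ → ℕ → (ℤ → ℕ) × Field → ℤ × ℕ := fun H j a =>
    rayState d x a.1 a.2 (rayStart d x f H a) j
  have hstart : ∀ H, Measurable (rayStart d x f H) := by
    intro H
    refine Measurable.prodMk ?_ ?_
    · have hx : Measurable fun a : (ℤ → ℕ) × Field => (a.1 x, a.2 x) := by fun_prop
      exact (hfm H).comp hx
    · exact (measurable_occ (some d) H).comp ((measurable_pi_apply x).comp measurable_snd)
  have hst : ∀ H j, Measurable (st H j) := by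
    intro H j
    have h1 : Measurable fun a : (ℤ → ℕ) × Field =>
        ((fun i : ℕ => a.1 (x + d * i)), (fun i : ℕ => a.2 (x + d * i))) := by fun_prop
    exact (measurable_side _ _ j).comp (h1.prodMk (hstart H))
  -- Chernoff bound with the weight `T ^ (-f)`.
  have hneg : ∀ H j, envLaw μ r {a | (st H j a).1 < 0} ≤
      M * (M * sleepWeight r T) ^ j := by
    intro H j
    have hW : Measurable fun a => (T : ℝ≥0∞) ^ (-(st H j a).1) :=
      (Measurable.of_discrete (f := fun b : ℤ × ℕ => (T : ℝ≥0∞) ^ (-b.1))).comp (hst H j)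
    have he : Function.Injective fun i : ℕ => x + d * (i : ℤ) := fun i j hij => by
      simpa [hd] using hij
    have hms : MeasurableSet {a | (st H j a).1 < 0} :=
      (hst H j) (MeasurableSet.of_discrete (s := {b : ℤ × ℕ | b.1 < 0}))
    calc _ = ∫⁻ a, {a | (st H j a).1 < 0}.indicator 1 a ∂envLaw μ r :=
          (lintegral_indicator_one hms).symm
      _ ≤ ∫⁻ a, (T : ℝ≥0∞) ^ (-(st H j a).1) ∂envLaw μ r := by
          refine lintegral_mono fun a => Set.indicator_apply_le' (fun ha => ?_) fun _ => zero_le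
          have ha' : (st H j a).1 < 0 := ha
          have := ENNReal.zpow_le_of_le (x := (T : ℝ≥0∞)) (by exact_mod_cast hT1)
            (a := 0) (b := -(st H j a).1) (by omega)
          simpa using this
      _ = ∫⁻ ζ, ∫⁻ F, (T : ℝ≥0∞) ^ (-(st H j (ζ, F)).1) ∂fieldLaw r
            ∂(Measure.infinitePi fun _ : ℤ => poissonMeasure μ) := lintegral_prod _ hW.aemeasurable
      _ ≤ ∫⁻ ζ : ℤ → ℕ, (T : ℝ≥0∞) ^ (∑ i ∈ Finset.range (j + 1), ζ (x + d * i)) *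
            sleepWeight r T ^ j ∂(Measure.infinitePi fun _ : ℤ => poissonMeasure μ) := by
          refine lintegral_mono fun ζ => ?_
          have := lintegral_side_le htw (some d) (T := T) (by exact_mod_cast hT1)
            ENNReal.coe_ne_top he (fun i => ζ (x + d * i))
            (fun w => (f H (ζ x) w, occ (some d) w H))
            (((hfm H).comp (measurable_const.prodMk measurable_id)).prodMk
              (measurable_occ (some d) H)) (fun w => by simpa using hf H (ζ x) w) j
          simpa [st, rayState, rayStart] using this
      _ = _ := by
          rw [lintegral_mul_const, lintegral_pow_sum _ _ he, mul_pow, pow_succ, ← hM]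
          · ring
          · exact (Measurable.of_discrete (f := fun n : ℕ => (T : ℝ≥0∞) ^ n)).comp (by fun_prop)
  have hC : ∀ J : ℕ, Tendsto (fun H => envLaw μ r
      {a | ∃ j < J, (st H j a).1 + (st H j a).2 < 0}) atTop (𝓝 0) := by
    intro J
    have hms : ∀ H, MeasurableSet {a | ∃ j < J, (st H j a).1 + (st H j a).2 < 0} := by
      intro H
      have : {a | ∃ j < J, (st H j a).1 + (st H j a).2 < 0} =
          ⋃ j ∈ Set.Iio J, {a | (st H j a).1 + (st H j a).2 < 0} := by
        ext a; simp
      rw [this]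
      exact MeasurableSet.biUnion (Set.to_countable _) fun j _ =>
        (hst H j) (MeasurableSet.of_discrete (s := {b : ℤ × ℕ | b.1 + b.2 < 0}))
    rw [← measure_empty (μ := envLaw μ r)]
    refine tendsto_measure_of_ae_tendsto_indicator_of_isFiniteMeasure atTop MeasurableSet.empty
      hms ?_
    have haw : ∀ᵐ a ∂envLaw μ r, instructionLaw lam p (some d) ≠ 0 →
        ∀ y, Recurrent (some d) (a.2 y) := by
      by_cases h0 : instructionLaw lam p (some d) ≠ 0
      · filter_upwards [ae_envLaw_of_stackLaw (ae_recurrent h0)] with a ha _ using ha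
      · exact Eventually.of_forall fun a ha => absurd ha h0
    filter_upwards [ae_envLaw_of_stackLaw (ae_recurrent htw), haw] with a ha1 ha2
    have ht : ∀ j, Tendsto (fun H => (st H j a).1 + ((st H j a).2 : ℤ)) atTop atTop := by
      intro j
      refine tendsto_side (q := fun H => rayStart d x f H a) (fun i => ha1 _)
        ⟨-(a.1 x : ℤ), fun H => hf H _ _⟩ ?_ j
      rcases h with h | h
      · refine Or.inl ⟨fun i => ha2 h _, ?_⟩
        exact tendsto_atTop_add_left_of_le _ _ (fun H => hf H _ _)
          (tendsto_natCast_atTop_atTop.comp (ha2 h x).tendsto_occ)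
      · exact Or.inr (h _ _ (ha1 x))
    have hall : ∀ᶠ H in atTop, ∀ j ∈ Finset.range J, 0 ≤ (st H j a).1 + ((st H j a).2 : ℤ) :=
      (Finset.eventually_all _).2 fun j _ => tendsto_atTop.1 (ht j) 0
    filter_upwards [hall] with H hH
    simp only [Set.mem_empty_iff_false, iff_false, not_exists, not_and, not_lt]
    exact fun j hj => hH j (Finset.mem_range.2 hj)
  have hsum : ∑' j, M * (M * sleepWeight r T) ^ j ≠ ∞ := by
    rw [ENNReal.tsum_mul_left, ENNReal.tsum_geometric]
    exact ENNReal.mul_ne_top hMfin (ENNReal.inv_ne_top.2 (tsub_pos_of_lt hT2).ne')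
  refine ENNReal.tendsto_nhds_zero.2 fun ε hε => ?_
  have hε2 : 0 < ε / 2 := ENNReal.half_pos hε.ne'
  obtain ⟨J, hJ⟩ := (ENNReal.tendsto_nhds_zero.1 (ENNReal.tendsto_sum_nat_add _ hsum) (ε / 2)
    hε2).exists
  filter_upwards [ENNReal.tendsto_nhds_zero.1 (hC J) (ε / 2) hε2] with H hH
  have hsub : rayBad d x f H ⊆ {a | ∃ j < J, (st H j a).1 + (st H j a).2 < 0} ∪
      ⋃ i, {a | (st H (i + J) a).1 < 0} := by
    rintro a ⟨j, hj⟩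
    by_cases hjJ : j < J
    · exact Or.inl ⟨j, hjJ, hj⟩
    · refine Or.inr (Set.mem_iUnion.2 ⟨j - J, ?_⟩)
      have hj' : (st H j a).1 + ((st H j a).2 : ℤ) < 0 := hj
      rw [Set.mem_ofPred_eq, Nat.sub_add_cancel (not_lt.1 hjJ)]
      omega
  calc _ ≤ _ := (measure_mono hsub).trans (measure_union_le _ _)
    _ ≤ ε / 2 + ε / 2 := by
        gcongr
        exact ((measure_iUnion_le _).trans (ENNReal.tsum_le_tsum fun i => hneg H (i + J))).trans hJ
    _ = ε := ENNReal.add_halves ε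

theorem particles_truncate_le (n : ℕ) (ζ : ℤ → ℕ) (y : ℤ) : (truncate n ζ y).particles ≤ ζ y := by
  change SiteState.particles (if y ∈ Finset.Icc (-(n : ℤ)) n then SiteState.num (ζ y) else 0) ≤ ζ y
  split_ifs
  · exact le_rfl
  · exact zero_le

/-! ### Gluing the half-lines, and conclusion. -/

/-- Two explored half-lines make up a stable configuration. -/
theorem not_reach_of_two_rays {x : ℤ} {ζ : ℤ → ℕ} {F : Field} (hF : NearestNeighbour F)
    (hr1 : ∀ y, Recurrent (some 1) (F y)) (hr2 : ∀ y, Recurrent (some (-1)) (F y)) {H : ℕ}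
    (h1 : (ζ, F) ∉ rayBad 1 x (fun _ m _ => -(m : ℤ)) H)
    (h2 : (ζ, F) ∉ rayBad (-1) x (fun _ _ _ => 0) H) {η : FinConfig}
    (hη : ∀ y, (η y).particles ≤ ζ y) : ¬ Reach x F η (2 * H + 2) := by
  intro hreach
  -- Balance at `x` requires the two net flows into `x` to add up to `-ζ x`; here the right
  -- half-line takes all of it.
  let q1 : ℤ × ℕ := (-(ζ x : ℤ), occ (some 1) (F x) H)
  let q2 : ℤ × ℕ := (0, occ (some (-1)) (F x) H)
  have hg1 : ∀ j, 0 ≤ (rayState 1 x ζ F q1 j).1 + (rayState 1 x ζ F q1 j).2 := by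
    simpa [rayBad, rayStart] using h1
  have hg2 : ∀ j, 0 ≤ (rayState (-1) x ζ F q2 j).1 + (rayState (-1) x ζ F q2 j).2 := by
    simpa [rayBad, rayStart] using h2
  let h : ℤ → ℕ := fun y => if y = x then H else if x < y then rayOdo 1 x ζ F q1 (y - x - 1).toNat
    else rayOdo (-1) x ζ F q2 (x - y - 1).toNat
  have hx : h x = H := by simp [h]
  have hh1 : ∀ j : ℕ, h (x + 1 * (j + 1)) = rayOdo 1 x ζ F q1 j := by
    intro j
    have e1 : ¬ (x + 1 * ((j : ℤ) + 1) = x) := by omega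
    have e2 : x < x + 1 * ((j : ℤ) + 1) := by omega
    have e3 : (x + 1 * ((j : ℤ) + 1) - x - 1).toNat = j := by omega
    simp only [h, if_neg e1, if_pos e2, e3]
  have hh2 : ∀ j : ℕ, h (x + -1 * (j + 1)) = rayOdo (-1) x ζ F q2 j := by
    intro j
    have e1 : ¬ (x + -1 * ((j : ℤ) + 1) = x) := by omega
    have e2 : ¬ (x < x + -1 * ((j : ℤ) + 1)) := by omega
    have e3 : (x - (x + -1 * ((j : ℤ) + 1)) - 1).toNat = j := by omega
    simp only [h, if_neg e1, if_neg e2, e3]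
  have hs1 := stableAt_ray (d := 1) (x := x) (h := h) (f := -(ζ x : ℤ)) (Or.inl rfl) hη hr2
    (by rw [hx]; exact hg1) (by rw [hx]; exact hh1)
  have hs2 := stableAt_ray (d := -1) (x := x) (h := h) (f := 0) (Or.inr rfl) hη
    (by simpa using hr1) (by rw [hx]; exact hg2) (by rw [hx]; exact hh2)
  have hs : ∀ y, StableAt F η h y := by
    intro y
    rcases lt_trichotomy y x with hy | rfl | hy
    · have := hs2 (x - y - 1).toNat
      rwa [show x + -1 * (((x - y - 1).toNat : ℤ) + 1) = y by omega] at this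
    · left
      have i1 := occ_rayOdo_toward (j := 0) (d := 1) hr2 hg1
      have i2 := occ_rayOdo_toward (j := 0) (d := -1) (by simpa using hr1) hg2
      rw [← hh1 0] at i1
      rw [← hh2 0] at i2
      simp only [Nat.cast_zero, zero_add, mul_one, rayState, side, q1, q2, neg_neg] at i1 i2
      have hp := hη y
      simp only [inflow, outflow, hx, sub_eq_add_neg]
      omega
    · have := hs1 (y - x - 1).toNat
      rwa [show x + 1 * (((y - x - 1).toNat : ℤ) + 1) = y by omega] at this
  have := hreach.le_of_stable' (V := Set.univ) (Set.mem_univ x) hF (fun y hy => absurd trivial hy)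
    fun y _ => hs y
  omega

/-- When all jumps are in one direction, one explored half-line suffices. -/
theorem not_reach_of_ray {d x : ℤ} (hd : d = 1 ∨ d = -1) {ζ : ℤ → ℕ} {F : Field}
    (hF : NearestNeighbour F) (hr : ∀ y, Recurrent (some (-d)) (F y))
    (hno : ∀ y n, F y n ≠ some d) {H : ℕ}
    (h1 : (ζ, F) ∉ rayBad d x (fun H m w => occ (some (-d)) w H - (m : ℤ)) H) {η : FinConfig}
    (hη : ∀ y, (η y).particles ≤ ζ y) : ¬ Reach x F η (2 * H + 2) := by
  intro hreach
  -- All jumps at `x` leave the half-line, so its first flow must be their number minus `ζ x`.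
  let q : ℤ × ℕ := (occ (some (-d)) (F x) H - (ζ x : ℤ), occ (some d) (F x) H)
  have hg : ∀ j, 0 ≤ (rayState d x ζ F q j).1 + (rayState d x ζ F q j).2 := by
    simpa [rayBad, rayStart] using h1
  let h : ℤ → ℕ := fun y => if y = x then H else rayOdo d x ζ F q (d * (y - x) - 1).toNat
  have hx : h x = H := by simp [h]
  have hh : ∀ j : ℕ, h (x + d * (j + 1)) = rayOdo d x ζ F q j := by
    intro j
    have e1 : ¬ (x + d * ((j : ℤ) + 1) = x) := by rcases hd with rfl | rfl <;> omega
    have e3 : (d * (x + d * ((j : ℤ) + 1) - x) - 1).toNat = j := by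
      rcases hd with rfl | rfl <;> omega
    simp only [h, if_neg e1, e3]
  have hs := stableAt_ray (h := h) (f := occ (some (-d)) (F x) H - (ζ x : ℤ)) hd hη hr
    (by rw [hx]; exact hg) (by rw [hx]; exact hh)
  -- Without jumps in direction `d` nothing enters this half-line from behind, so stability is
  -- needed only on it.
  let V : Set ℤ := {y | 0 ≤ d * (y - x)}
  have hV : Closed F V := by
    intro y hy
    simp only [V, Set.mem_ofPred_eq] at hy ⊢
    rcases hd with rfl | rfl
    · exact ⟨fun _ n => hno y n, fun h => by omega⟩
    · exact ⟨fun h => by omega, fun _ n => hno y n⟩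
  have hsV : ∀ y ∈ V, StableAt F η h y := by
    intro y hy
    simp only [V, Set.mem_ofPred_eq] at hy
    by_cases hyx : y = x
    · subst hyx
      left
      have i1 := occ_rayOdo_toward (j := 0) hr hg
      rw [← hh 0] at i1
      simp only [Nat.cast_zero, zero_add, mul_one, rayState, side, q] at i1
      have hp := hη y
      rw [inflow_eq F h hd, outflow_eq F h hd, hx, occ_eq_zero (hno (y - d))]
      omega
    · have := hs (d * (y - x) - 1).toNat
      have e : x + d * (((d * (y - x) - 1).toNat : ℤ) + 1) = y := by
        rcases hd with rfl | rfl <;> omega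
      rwa [e] at this
  have := hreach.le_of_stable' (V := V) (by simp [V]) hF hV hsV
  omega

/-- An event of small probability controls the average reaching probabilities. -/
theorem lintegral_reachProb_le {μ : ℝ≥0} {r : PMF Instruction} {x : ℤ} {c : ℕ}
    {B : Set ((ℤ → ℕ) × Field)} {n : ℕ}
    (h : ∀ᵐ a ∂envLaw μ r, a ∉ B → ¬ Reach x a.2 (truncate n a.1) c) :
    ∫⁻ ζ, reachProb r x (truncate n ζ) c ∂(Measure.infinitePi fun _ : ℤ => poissonMeasure μ) ≤
      envLaw μ r B := by
  let S : Set ((ℤ → ℕ) × Field) := {a | Reach x a.2 (truncate n a.1) c}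
  have hS : envLaw μ r S ≤ envLaw μ r B := by
    refine measure_mono_ae ?_
    filter_upwards [h] with a ha hS
    by_contra hB
    exact ha hB hS
  refine le_trans ?_ hS
  -- A measurable hull again replaces a set that is not known to be measurable.
  rw [← measure_toMeasurable S, envLaw, Measure.prod_apply (measurableSet_toMeasurable _ _)]
  exact lintegral_mono fun ζ => measure_mono fun F hF => subset_toMeasurable _ S hF

theorem nearestNeighbour_of_support {lam : ℝ≥0} {p : PMF ℤ} (hp : ∀ z : ℤ, |z| ≠ 1 → p z = 0)
    {F : Field} (hF : ∀ y n, instructionLaw lam p (F y n) ≠ 0) : NearestNeighbour F := by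
  intro y n
  have h := hF y n
  rcases hyn : F y n with _ | z
  · exact Or.inl rfl
  · rw [hyn, instructionLaw_some] at h
    have hz : |z| = 1 := by
      by_contra hc
      exact h (by rw [hp z hc, zero_mul])
    rcases (abs_eq zero_le_one).1 hz with rfl | rfl
    · exact Or.inr (Or.inl rfl)
    · exact Or.inr (Or.inr rfl)

theorem instructionLaw_some_ne_zero {lam : ℝ≥0} {p : PMF ℤ} {z : ℤ} (h : p z ≠ 0) :
    instructionLaw lam p (some z) ≠ 0 := by
  rw [instructionLaw_some]
  refine mul_ne_zero h ?_
  have : (0 : ℝ≥0) < 1 / (1 + lam) := by positivity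
  exact_mod_cast this.ne'

/-- Totally asymmetric case, with `d` pointing upstream: there are no jumps away from `x`, but the
initial flow grows with the number of jumps among the `H` instructions at `x`. -/
theorem exists_reachProb_le_of_ray {lam μ : ℝ≥0} (hμ : μ < lam / (1 + lam)) {p : PMF ℤ}
    (hp : ∀ z : ℤ, |z| ≠ 1 → p z = 0) {d : ℤ} (hd : d = 1 ∨ d = -1) (h0 : p d = 0)
    (h1 : p (-d) ≠ 0) (x : ℤ) {ε : ℝ≥0∞} (hε : 0 < ε) :
    ∃ K, ∀ n, ∫⁻ ζ, reachProb (instructionLaw lam p) x (truncate n ζ) K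
      ∂(Measure.infinitePi fun _ : ℤ => poissonMeasure μ) ≤ ε := by
  have htw := instructionLaw_some_ne_zero (lam := lam) h1
  have hd0 : d ≠ 0 := by rcases hd with rfl | rfl <;> norm_num
  have hlim := tendsto_rayBad hμ p hd0 x htw (fun H m w => occ (some (-d)) w H - (m : ℤ))
    (fun H => by
      have hm : Measurable fun a : ℕ × (ℕ → Instruction) => (a.1, occ (some (-d)) a.2 H) :=
        measurable_fst.prodMk ((measurable_occ (some (-d)) H).comp measurable_snd)
      exact (Measurable.of_discrete (f := fun b : ℕ × ℕ => (b.2 : ℤ) - b.1)).comp hm)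
    (fun H m w => by omega)
    (Or.inr fun m w hw => tendsto_atTop_add_const_right _ (-(m : ℤ))
      (tendsto_natCast_atTop_atTop.comp hw.tendsto_occ))
  obtain ⟨H, hH⟩ := (ENNReal.tendsto_nhds_zero.1 hlim ε hε).exists
  -- One more than the bound `2 * H + 1` of `Reach.le_of_stable'`.
  refine ⟨2 * H + 2, fun n => (lintegral_reachProb_le ?_).trans hH⟩
  filter_upwards [ae_envLaw_of_stackLaw (ae_recurrent htw),
    ae_envLaw_of_stackLaw (ae_stackLaw_support (instructionLaw lam p))] with a ha1 ha2 hB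
  refine not_reach_of_ray hd (nearestNeighbour_of_support hp ha2) ha1 (fun y n hyn => ?_) hB
    (particles_truncate_le n a.1)
  refine ha2 y n ?_
  rw [hyn, instructionLaw_some, h0, zero_mul]

/-- The initial flows do not grow with `H` here; it is the jumps away from `x` that diverge, on both
sides with the same `H`. -/
theorem exists_reachProb_le_of_two_rays {lam μ : ℝ≥0} (hμ : μ < lam / (1 + lam)) {p : PMF ℤ}
    (hp : ∀ z : ℤ, |z| ≠ 1 → p z = 0) (h1 : p 1 ≠ 0) (h2 : p (-1) ≠ 0) (x : ℤ) {ε : ℝ≥0∞}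
    (hε : 0 < ε) :
    ∃ K, ∀ n, ∫⁻ ζ, reachProb (instructionLaw lam p) x (truncate n ζ) K
      ∂(Measure.infinitePi fun _ : ℤ => poissonMeasure μ) ≤ ε := by
  have hr1 := instructionLaw_some_ne_zero (lam := lam) h1
  have hr2 := instructionLaw_some_ne_zero (lam := lam) h2
  have hε2 : 0 < ε / 2 := ENNReal.half_pos hε.ne'
  have hlim1 := tendsto_rayBad hμ p one_ne_zero x hr2 (fun _ m _ => -(m : ℤ))
    (fun H => (Measurable.of_discrete (f := fun m : ℕ => -(m : ℤ))).comp measurable_fst)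
    (fun H m w => le_rfl) (Or.inl hr1)
  have hlim2 := tendsto_rayBad hμ p (d := -1) (by norm_num) x (by simpa using hr1)
    (fun _ _ _ => 0) (fun H => measurable_const) (fun H m w => by omega) (Or.inl hr2)
  obtain ⟨H, hH1, hH2⟩ := ((ENNReal.tendsto_nhds_zero.1 hlim1 (ε / 2) hε2).and
    (ENNReal.tendsto_nhds_zero.1 hlim2 (ε / 2) hε2)).exists
  refine ⟨2 * H + 2, fun n => (lintegral_reachProb_le
    (B := rayBad 1 x (fun _ m _ => -(m : ℤ)) H ∪ rayBad (-1) x (fun _ _ _ => 0) H) ?_).trans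
      ((measure_union_le _ _).trans ((add_le_add hH1 hH2).trans_eq (ENNReal.add_halves ε)))⟩
  filter_upwards [ae_envLaw_of_stackLaw (ae_recurrent hr1),
    ae_envLaw_of_stackLaw (ae_recurrent hr2),
    ae_envLaw_of_stackLaw (ae_stackLaw_support (instructionLaw lam p))] with a ha1 ha2 ha3 hB
  exact not_reach_of_two_rays (nearestNeighbour_of_support hp ha3) ha1 ha2
    (fun h => hB (Or.inl h)) (fun h => hB (Or.inr h)) (particles_truncate_le n a.1)

theorem fixatesAS_of_lt {lam μ : ℝ≥0} (hμ : μ < lam / (1 + lam)) {p : PMF ℤ}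
    (hp : ∀ z : ℤ, |z| ≠ 1 → p z = 0) : FixatesAS.{u} lam p μ := by
  refine fixatesAS_of_tight fun x ε hε => ?_
  suffices ∃ K, ∀ n, ∫⁻ ζ, reachProb (instructionLaw lam p) x (truncate n ζ) K
      ∂(Measure.infinitePi fun _ : ℤ => poissonMeasure μ) ≤ ε by
    obtain ⟨K, hK⟩ := this
    exact ⟨K, fun n => (finLaw_changes_le lam p μ n x K).trans (hK n)⟩
  obtain ⟨z, hz⟩ := p.support_nonempty
  have hz' : p z ≠ 0 := (PMF.mem_support_iff p z).1 hz
  have hz1 : |z| = 1 := by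
    by_contra hc
    exact hz' (hp z hc)
  by_cases h1 : p 1 = 0
  · refine exists_reachProb_le_of_ray hμ hp (Or.inl rfl) h1 ?_ x hε
    rcases (abs_eq zero_le_one).1 hz1 with rfl | rfl
    · exact absurd h1 hz'
    · exact hz'
  by_cases h2 : p (-1) = 0
  · exact exists_reachProb_le_of_ray hμ hp (Or.inr rfl) h2 (by simpa using h1) x hε
  · exact exists_reachProb_le_of_two_rays hμ hp h1 h2 x hε

end ARW

end

theorem mainTheorem2 (lam : NNReal) (hlam : 0 < lam)
    (p : PMF ℤ) (hp : ∀ z : ℤ, |z| ≠ 1 → p z = 0) :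
    (∀ μ : NNReal, μ < lam / (1 + lam) → ARW.FixatesAS.{u} lam p μ) ∧
      ((lam / (1 + lam) : NNReal) : ENNReal) ≤ ARW.criticalDensity.{u} lam p := by
  refine ⟨fun μ hμ => ARW.fixatesAS_of_lt hμ hp, le_of_forall_lt fun c hc => ?_⟩
  obtain ⟨b, hb1, hb2⟩ := ENNReal.lt_iff_exists_nnreal_btwn.1 hc
  exact hb1.trans_le (le_iSup₂_of_le b (ARW.fixatesAS_of_lt (by exact_mod_cast hb2) hp) le_rfl)
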